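/- Let $k$ be a field, $d,\ell\ge 0$ integers, $q\in k^*$ with $q\neq 1$, and $\mathbf Q=(Q_1,\dots,Q_\ell)\in (k^*)^\ell$. Put $n=\ell+d$ and let $J^{\ell,d}\subset\{0,1\}^{n}$ be the set of sequences $\mathbf c=(c_1,\dots,c_n)$ with $\sum_i c_i=\ell$; $\mathfrak S_n$ acts on it by $w(\mathbf c)_m=c_{w^{-1}(m)}$, and $s_r=(r\;r+1)$. The higher level affine Hecke algebra $H_{d,\mathbf Q}(q)$ is the $k$-algebra generated by $e(\mathbf c)$ ($\mathbf c\in J^{\ell,d}$), $T_r$ ($1\le r\le n-1$), $X_i,X_i'$ ($1\le i\le n$), subject to the relations (for all admissible indices) * $\sum_{\mathbf c}e(\mathbf c)=1$, $e(\mathbf c)^2=e(\mathbf c)$; $X_ie(\mathbf c)=X_i'e(\mathbf c)=0$ if $c_i=1$; $X_iX_i'e(\mathbf c)=X_i'X_ie(\mathbf c)=e(\mathbf c)$ if $c_i=0$; * $X_ie(\mathbf c)=e(\mathbf c)X_i$, $X'_ie(\mathbf c)=e(\mathbf c)X'_i$, $X_iX_j=X_jX_i$, $X_i'X_j'=X_j'X_i'$;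 * $T_rT_s=T_sT_r$ if $|r-s|>1$; $T_rX_i=X_iT_r$ if $i\ne r,r+1$; $T_re(\mathbf c)=0$ if $c_r=c_{r+1}=1$; $T_re(\mathbf c)=e(s_r(\mathbf c))T_r$; * $(T_rX_{r+1}-X_rT_r)e(\mathbf c)$ equals $(q-1)X_{r+1}e(\mathbf c)$ if $c_r=c_{r+1}=0$ and $0$ otherwise; $(T_rX_r-X_{r+1}T_r)e(\mathbf c)$ equals $-(q-1)X_{r+1}e(\mathbf c)$ if $c_r=c_{r+1}=0$ and $0$ otherwise; * $T_r^2e(\mathbf c)$ equals $(q-1)T_re(\mathbf c)+q\,e(\mathbf c)$ if $c_r=c_{r+1}=0$, $\bigl(X_r-Q_{\sum_{j\le r+1}c_j}\bigr)e(\mathbf c)$ if $c_r=0,c_{r+1}=1$, and $\bigl(X_{r+1}-Q_{\sum_{j\le r}c_j}\bigr)e(\mathbf c)$ if $c_r=1,c_{r+1}=0$; * for $r<n-1$, $(T_rT_{r+1}T_r-T_{r+1}T_rT_{r+1})e(\mathbf c)$ equals $0$ if $c_{r+1}=0$, and $(1-q)X_{r+2}e(\mathbf c)$ if $c_{r+1}=1$,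 $c_r=c_{r+2}=0$. For $\mathbf c\in J^{\ell,d}$ let $1_{\mathbf c}<\dots<d_{\mathbf c}$ be the positions $i$ with $c_i=0$, let $P(\mathbf c)$ be the Laurent polynomial ring over $k$ in the variables $X_{1_{\mathbf c}},\dots,X_{d_{\mathbf c}}$, and let $P_{d,\mathbf Q}=\bigoplus_{\mathbf c}P(\mathbf c)$ with componentwise multiplication, on which $w\in\mathfrak S_{\ell+d}$ acts by $P(\mathbf c)\to P(w(\mathbf c))$, $X_i\mapsto X_{w(i)}$. Let $$\iota: k[x_1^{\pm1},\dots,x_d^{\pm1}]\to H_{d,\mathbf Q}(q),\qquad x_t\mapsto\sum_{\mathbf c}X_{t_{\mathbf c}}e(\mathbf c)$$ be the diagonal homomorphism, and let $\iota_P:P_{d,\mathbf Q}\to H_{d,\mathbf Q}(q)$ be the homomorphism that sends $1\in P(\mathbf c)$ to $e(\mathbf c)$ and $X_i\in P(\mathbf c)$ to $X_ie(\mathbf c)$. **Proposition.** Both $\iota$ and $\iota_P$ are injective, and, identifying their sources with their images, the centre of $H_{d,\mathbf Q}(q)$ is $$Z(H_{d,\mathbf Q}(q))=k[x_1^{\pm1},\dots,x_d^{\pm1}]^{\mathfrak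 S_d}=P_{d,\mathbf Q}^{\mathfrak S_{\ell+d}}.$$ In particular the centre is independent of the level: for any $\ell'\ge0$ and $\mathbf Q'\in(k^*)^{\ell'}$ there is an isomorphism of $k$-algebras $Z(H_{d,\mathbf Q}(q))\cong Z(H_{d,\mathbf Q'}(q))$ that identifies the images of each symmetric Laurent polynomial. -/

import Mathlib

namespace HigherHecke

noncomputable section

/-! ### Colour sequences -/

/-- `J^{ℓ,d}`: sequences of `ℓ + d` colours (`0` is black, `1` is red) with exactly `ℓ` red entries.
Positions are numbered from `0`. -/
def J (d ℓ : ℕ) : Type := {c : Fin (ℓ + d) → Fin 2 // ∑ i, (c i : ℕ) = ℓ}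

instance (d ℓ : ℕ) : Fintype (J d ℓ) :=
  inferInstanceAs (Fintype {c : Fin (ℓ + d) → Fin 2 // ∑ i, (c i : ℕ) = ℓ})

instance (d ℓ : ℕ) : DecidableEq (J d ℓ) :=
  inferInstanceAs (DecidableEq {c : Fin (ℓ + d) → Fin 2 // ∑ i, (c i : ℕ) = ℓ})

variable {d ℓ : ℕ}

/-- The action of the symmetric group on colour sequences: `(w c)_m = c_{w⁻¹ m}`. -/
def J.permute (w : Equiv.Perm (Fin (ℓ + d))) (c : J d ℓ) : J d ℓ :=
  ⟨fun m => c.1 (w⁻¹ m), by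
    rw [Equiv.sum_comp w⁻¹ (fun i => ((c.1 i : Fin 2) : ℕ))]; exact c.2⟩

/-- The number of red entries strictly to the left of a red position; this is the (zero-based)
index of the parameter attached to that red entry. -/
def J.redIndex (c : J d ℓ) (i : Fin (ℓ + d)) (h : c.1 i = 1) : Fin ℓ :=
  ⟨∑ j ∈ Finset.univ.filter (fun j => j < i), (c.1 j : ℕ), by
    have h1 : ∑ j ∈ insert i (Finset.univ.filter (fun j => j < i)), (c.1 j : ℕ)
        ≤ ∑ j, (c.1 j : ℕ) :=
      Finset.sum_le_sum_of_subset (Finset.subset_univ _)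
    rw [Finset.sum_insert (by simp), c.2, h] at h1
    simp only [Fin.val_one] at h1
    omega⟩

/-- The positions of the black entries. -/
def J.blacks (c : J d ℓ) : Finset (Fin (ℓ + d)) := Finset.univ.filter (fun i => c.1 i = 0)

theorem J.card_blacks (c : J d ℓ) : c.blacks.card = d := by
  have h1 : ∀ i, (c.1 i : ℕ) = if c.1 i = 0 then 0 else 1 := by
    intro i
    generalize c.1 i = a
    fin_cases a <;> rfl
  have h2 := c.2
  rw [Finset.sum_congr rfl (fun i _ => h1 i), Finset.sum_ite] at h2
  simp only [Finset.sum_const_zero, zero_add, Finset.sum_const, smul_eq_mul, mul_one] at h2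
  have h3 := Finset.card_filter_add_card_filter_not (s := (Finset.univ : Finset (Fin (ℓ + d))))
    (fun i => c.1 i = 0)
  rw [Finset.card_univ, Fintype.card_fin] at h3
  unfold J.blacks
  omega

/-- The increasing enumeration `t ↦ t_c` of the black positions of `c`. -/
def J.blackIso (c : J d ℓ) : Fin d ≃o c.blacks := c.blacks.orderIsoOfFin c.card_blacks

/-- The position `t_c` at which black appears for the `t`-th time. -/
def J.pos (c : J d ℓ) (t : Fin d) : Fin (ℓ + d) := (c.blackIso t).1

theorem J.pos_black (c : J d ℓ) (t : Fin d) : c.1 (c.pos t) = 0 := by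
  have h : c.pos t ∈ c.blacks := (c.blackIso t).2
  exact (Finset.mem_filter.1 h).2

/-! ### The higher level affine Hecke algebra -/

/-- Generators. `T r` is defined for the (zero-based) `r` with `r + 1 < ℓ + d`. -/
inductive Gen (d ℓ : ℕ) : Type
  | e (c : J d ℓ) : Gen d ℓ
  | T (r : ℕ) (hr : r + 1 < ℓ + d) : Gen d ℓ
  | X (i : Fin (ℓ + d)) : Gen d ℓ
  | X' (i : Fin (ℓ + d)) : Gen d ℓ

section Algebra

variable {k : Type*} [Field k]

variable (k) in
/-- The generators as elements of the free algebra. -/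
abbrev fe (c : J d ℓ) : FreeAlgebra k (Gen d ℓ) := FreeAlgebra.ι k (Gen.e c)

variable (k) in
/-- The generators as elements of the free algebra. -/
abbrev fT (r : ℕ) (hr : r + 1 < ℓ + d) : FreeAlgebra k (Gen d ℓ) := FreeAlgebra.ι k (Gen.T r hr)

variable (k) in
/-- The generators as elements of the free algebra. -/
abbrev fX (i : Fin (ℓ + d)) : FreeAlgebra k (Gen d ℓ) := FreeAlgebra.ι k (Gen.X i)

variable (k) in
/-- The generators as elements of the free algebra. -/
abbrev fX' (i : Fin (ℓ + d)) : FreeAlgebra k (Gen d ℓ) := FreeAlgebra.ι k (Gen.X' i)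

/-- The position `r`. -/
abbrev lo (r : ℕ) (hr : r + 1 < ℓ + d) : Fin (ℓ + d) := ⟨r, Nat.lt_of_succ_lt hr⟩

/-- The position `r + 1`. -/
abbrev hi (r : ℕ) (hr : r + 1 < ℓ + d) : Fin (ℓ + d) := ⟨r + 1, hr⟩

/-- The defining relations. -/
inductive Rel (q : k) (Q : Fin ℓ → k) :
    FreeAlgebra k (Gen d ℓ) → FreeAlgebra k (Gen d ℓ) → Prop
  | e_sum : Rel q Q (∑ c, fe k c) 1
  | e_idem (c) : Rel q Q (fe k c * fe k c) (fe k c)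
  | X_red (i) (c : J d ℓ) (h : c.1 i = 1) : Rel q Q (fX k i * fe k c) 0
  | X'_red (i) (c : J d ℓ) (h : c.1 i = 1) : Rel q Q (fX' k i * fe k c) 0
  | X_X' (i) (c : J d ℓ) (h : c.1 i = 0) : Rel q Q (fX k i * fX' k i * fe k c) (fe k c)
  | X'_X (i) (c : J d ℓ) (h : c.1 i = 0) : Rel q Q (fX' k i * fX k i * fe k c) (fe k c)
  | X_e (i) (c) : Rel q Q (fX k i * fe k c) (fe k c * fX k i)
  | X'_e (i) (c) : Rel q Q (fX' k i * fe k c) (fe k c * fX' k i)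
  | X_comm (i j) : Rel q Q (fX k i * fX k j) (fX k j * fX k i)
  | X'_comm (i j) : Rel q Q (fX' k i * fX' k j) (fX' k j * fX' k i)
  | T_comm (r s hr hs) (h : r + 1 < s ∨ s + 1 < r) :
      Rel q Q (fT k r hr * fT k s hs) (fT k s hs * fT k r hr)
  | T_X_comm (r hr) (i) (h0 : i ≠ lo r hr) (h1 : i ≠ hi r hr) :
      Rel q Q (fT k r hr * fX k i) (fX k i * fT k r hr)
  | T_red (r hr) (c : J d ℓ) (h0 : c.1 (lo r hr) = 1) (h1 : c.1 (hi r hr) = 1) :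
      Rel q Q (fT k r hr * fe k c) 0
  | T_e (r hr) (c : J d ℓ) :
      Rel q Q (fT k r hr * fe k c) (fe k (c.permute (Equiv.swap (lo r hr) (hi r hr))) * fT k r hr)
  | T_X_hi_black (r hr) (c : J d ℓ) (h0 : c.1 (lo r hr) = 0) (h1 : c.1 (hi r hr) = 0) :
      Rel q Q ((fT k r hr * fX k (hi r hr) - fX k (lo r hr) * fT k r hr) * fe k c)
        ((q - 1) • (fX k (hi r hr) * fe k c))
  | T_X_hi_red (r hr) (c : J d ℓ) (h : ¬ (c.1 (lo r hr) = 0 ∧ c.1 (hi r hr) = 0)) :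
      Rel q Q ((fT k r hr * fX k (hi r hr) - fX k (lo r hr) * fT k r hr) * fe k c) 0
  | T_X_lo_black (r hr) (c : J d ℓ) (h0 : c.1 (lo r hr) = 0) (h1 : c.1 (hi r hr) = 0) :
      Rel q Q ((fT k r hr * fX k (lo r hr) - fX k (hi r hr) * fT k r hr) * fe k c)
        (-((q - 1) • (fX k (hi r hr) * fe k c)))
  | T_X_lo_red (r hr) (c : J d ℓ) (h : ¬ (c.1 (lo r hr) = 0 ∧ c.1 (hi r hr) = 0)) :
      Rel q Q ((fT k r hr * fX k (lo r hr) - fX k (hi r hr) * fT k r hr) * fe k c) 0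
  | T_sq_black (r hr) (c : J d ℓ) (h0 : c.1 (lo r hr) = 0) (h1 : c.1 (hi r hr) = 0) :
      Rel q Q (fT k r hr * fT k r hr * fe k c)
        ((q - 1) • (fT k r hr * fe k c) + q • fe k c)
  | T_sq_black_red (r hr) (c : J d ℓ) (h0 : c.1 (lo r hr) = 0) (h1 : c.1 (hi r hr) = 1) :
      Rel q Q (fT k r hr * fT k r hr * fe k c)
        (fX k (lo r hr) * fe k c - Q (c.redIndex (hi r hr) h1) • fe k c)
  | T_sq_red_black (r hr) (c : J d ℓ) (h0 : c.1 (lo r hr) = 1) (h1 : c.1 (hi r hr) = 0) :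
      Rel q Q (fT k r hr * fT k r hr * fe k c)
        (fX k (hi r hr) * fe k c - Q (c.redIndex (lo r hr) h0) • fe k c)
  | braid (r : ℕ) (hr : r + 1 < ℓ + d) (hr' : r + 1 + 1 < ℓ + d) (c : J d ℓ)
      (h : c.1 (hi r hr) = 0) :
      Rel q Q ((fT k r hr * fT k (r + 1) hr' * fT k r hr
        - fT k (r + 1) hr' * fT k r hr * fT k (r + 1) hr') * fe k c) 0
  | braid_red (r : ℕ) (hr : r + 1 < ℓ + d) (hr' : r + 1 + 1 < ℓ + d) (c : J d ℓ)
      (h0 : c.1 (lo r hr) = 0) (h1 : c.1 (hi r hr) = 1) (h2 : c.1 (hi (r + 1) hr') = 0) :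
      Rel q Q ((fT k r hr * fT k (r + 1) hr' * fT k r hr
        - fT k (r + 1) hr' * fT k r hr * fT k (r + 1) hr') * fe k c)
        ((1 - q) • (fX k (hi (r + 1) hr') * fe k c))

variable (d) in
/-- The higher level affine Hecke algebra `H_{d,Q}(q)` of rank `d` and level `ℓ`. -/
abbrev Hecke (q : k) (Q : Fin ℓ → k) : Type _ := RingQuot (Rel (d := d) q Q)

variable (q : k) (Q : Fin ℓ → k)

/-- The generator `e(c)` of the Hecke algebra. -/
def e (c : J d ℓ) : Hecke d q Q := RingQuot.mkAlgHom k (Rel q Q) (fe k c)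

/-- The generator `T_r` of the Hecke algebra. -/
def T (r : ℕ) (hr : r + 1 < ℓ + d) : Hecke d q Q := RingQuot.mkAlgHom k (Rel q Q) (fT k r hr)

/-- The generator `X_i` of the Hecke algebra. -/
def X (i : Fin (ℓ + d)) : Hecke d q Q := RingQuot.mkAlgHom k (Rel q Q) (fX k i)

/-- The generator `X'_i` of the Hecke algebra. -/
def X' (i : Fin (ℓ + d)) : Hecke d q Q := RingQuot.mkAlgHom k (Rel q Q) (fX' k i)

theorem sum_e : ∑ c : J d ℓ, e q Q c = 1 := by
  have h := RingQuot.mkAlgHom_rel k (Rel.e_sum (d := d) (q := q) (Q := Q))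
  simp only [map_sum, map_one] at h
  exact h

theorem e_mul_self (c : J d ℓ) : e q Q c * e q Q c = e q Q c := by
  have h := RingQuot.mkAlgHom_rel k (Rel.e_idem (q := q) (Q := Q) c)
  simp only [map_mul] at h
  exact h

theorem X_mul_e_red (i) (c : J d ℓ) (h : c.1 i = 1) : X q Q i * e q Q c = 0 := by
  have h := RingQuot.mkAlgHom_rel k (Rel.X_red (q := q) (Q := Q) i c h)
  simp only [map_mul, map_zero] at h
  exact h

theorem X_X'_e (i) (c : J d ℓ) (h : c.1 i = 0) :
    X q Q i * X' q Q i * e q Q c = e q Q c := by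
  have h := RingQuot.mkAlgHom_rel k (Rel.X_X' (q := q) (Q := Q) i c h)
  simp only [map_mul] at h
  exact h

theorem X'_X_e (i) (c : J d ℓ) (h : c.1 i = 0) :
    X' q Q i * X q Q i * e q Q c = e q Q c := by
  have h := RingQuot.mkAlgHom_rel k (Rel.X'_X (q := q) (Q := Q) i c h)
  simp only [map_mul] at h
  exact h

theorem X_comm_e (i) (c : J d ℓ) : X q Q i * e q Q c = e q Q c * X q Q i := by
  have h := RingQuot.mkAlgHom_rel k (Rel.X_e (q := q) (Q := Q) i c)
  simp only [map_mul] at h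
  exact h

theorem X'_comm_e (i) (c : J d ℓ) : X' q Q i * e q Q c = e q Q c * X' q Q i := by
  have h := RingQuot.mkAlgHom_rel k (Rel.X'_e (q := q) (Q := Q) i c)
  simp only [map_mul] at h
  exact h

theorem X_comm_X (i j : Fin (ℓ + d)) : X q Q i * X q Q j = X q Q j * X q Q i := by
  have h := RingQuot.mkAlgHom_rel k (Rel.X_comm (q := q) (Q := Q) i j)
  simp only [map_mul] at h
  exact h

theorem e_mul_e_of_ne (b c : J d ℓ) (hbc : b ≠ c) : e q Q b * e q Q c = 0 := by
  obtain ⟨i, hb, hc⟩ : ∃ i, b.1 i = 1 ∧ c.1 i = 0 := by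
    by_contra! hcon
    apply hbc
    have hle : ∀ i ∈ (Finset.univ : Finset (Fin (ℓ + d))), ((b.1 i : Fin 2) : ℕ) ≤ c.1 i := by
      intro i _
      have := hcon i
      generalize b.1 i = x at *
      generalize c.1 i = y at *
      fin_cases x <;> fin_cases y <;> simp_all
    have heq := (Finset.sum_eq_sum_iff_of_le hle).1 (b.2.trans c.2.symm)
    exact Subtype.ext (funext fun i => Fin.ext (heq i (Finset.mem_univ i)))
  calc e q Q b * e q Q c = e q Q b * (X q Q i * X' q Q i * e q Q c) := by rw [X_X'_e q Q i c hc]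
    _ = (X q Q i * e q Q b) * (X' q Q i * e q Q c) := by rw [X_comm_e]; simp only [mul_assoc]
    _ = 0 := by rw [X_mul_e_red q Q i b hb, zero_mul]

/-- Products of block-diagonal elements. -/
theorem sum_mul_sum (A B : J d ℓ → Hecke d q Q) (hB : ∀ c, B c * e q Q c = e q Q c * B c) :
    (∑ c, A c * e q Q c) * (∑ c, B c * e q Q c) = ∑ c, A c * B c * e q Q c := by
  rw [Finset.sum_mul]
  refine Finset.sum_congr rfl fun c _ => ?_
  rw [Finset.mul_sum, Finset.sum_eq_single c]
  · calc A c * e q Q c * (B c * e q Q c) = A c * (e q Q c * B c) * e q Q c := by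
          simp only [mul_assoc]
      _ = A c * B c * (e q Q c * e q Q c) := by rw [← hB]; simp only [mul_assoc]
      _ = _ := by rw [e_mul_self]
  · intro b _ hb
    rw [hB, mul_assoc, ← mul_assoc (e q Q c), e_mul_e_of_ne q Q c b hb.symm, zero_mul, mul_zero]
  · simp

/-- The element `x_t = ∑_c X_{t_c} e(c)`, as a unit with inverse `∑_c X'_{t_c} e(c)`. -/
def xUnit (t : Fin d) : (Hecke d q Q)ˣ where
  val := ∑ c : J d ℓ, X q Q (c.pos t) * e q Q c
  inv := ∑ c : J d ℓ, X' q Q (c.pos t) * e q Q c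
  val_inv := by
    rw [sum_mul_sum q Q _ _ fun c => X'_comm_e q Q _ c, ← sum_e q Q]
    exact Finset.sum_congr rfl fun c _ => X_X'_e q Q _ c (c.pos_black t)
  inv_val := by
    rw [sum_mul_sum q Q _ _ fun c => X_comm_e q Q _ c, ← sum_e q Q]
    exact Finset.sum_congr rfl fun c _ => X'_X_e q Q _ c (c.pos_black t)

theorem xUnit_commute (s t : Fin d) : Commute (xUnit q Q s) (xUnit q Q t) := by
  apply Units.ext
  change (∑ c : J d ℓ, X q Q (c.pos s) * e q Q c) * (∑ c : J d ℓ, X q Q (c.pos t) * e q Q c)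
    = (∑ c : J d ℓ, X q Q (c.pos t) * e q Q c) * (∑ c : J d ℓ, X q Q (c.pos s) * e q Q c)
  rw [sum_mul_sum q Q _ _ fun c => X_comm_e q Q _ c, sum_mul_sum q Q _ _ fun c => X_comm_e q Q _ c]
  exact Finset.sum_congr rfl fun c _ => by rw [X_comm_X]

theorem e_commute_xUnit (c : J d ℓ) (t : Fin d) :
    Commute (e q Q c) (xUnit q Q t : Hecke d q Q) := by
  change e q Q c * (∑ b : J d ℓ, X q Q (b.pos t) * e q Q b)
    = (∑ b : J d ℓ, X q Q (b.pos t) * e q Q b) * e q Q c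
  rw [Finset.mul_sum, Finset.sum_mul]
  refine Finset.sum_congr rfl fun b _ => ?_
  rw [← mul_assoc, ← X_comm_e, mul_assoc, mul_assoc]
  by_cases h : b = c
  · rw [h]
  · rw [e_mul_e_of_ne q Q b c h, e_mul_e_of_ne q Q c b (Ne.symm h)]

end Algebra

/-! ### Laurent polynomials -/

section Laurent

variable (k : Type*) [Field k]

/-- The Laurent polynomial ring `k[x_i^{±1} : i ∈ σ]` in a finite set of variables: the group
algebra of the free abelian group `ℤ^σ`. -/
abbrev Laurent (σ : Type*) : Type _ := AddMonoidAlgebra k (σ → ℤ)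

/-- The variable `x_i`. -/
def Laurent.x {σ : Type*} [DecidableEq σ] (i : σ) : Laurent k σ :=
  AddMonoidAlgebra.single (Pi.single i 1) 1

/-- Renaming the variables along a bijection: `x_i ↦ x_{w i}`. -/
def Laurent.rename {σ τ : Type*} (w : σ ≃ τ) : Laurent k σ ≃ₐ[k] Laurent k τ :=
  AddMonoidAlgebra.domCongr k k
    { toFun := fun a j => a (w.symm j)
      invFun := fun b i => b (w i)
      left_inv := fun a => by funext i; simp
      right_inv := fun b => by funext j; simp
      map_add' := fun _ _ => rfl }

/-- The symmetric Laurent polynomials `k[x_1^{±1}, …, x_d^{±1}]^{S_d}`. -/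
def symmetricLaurent (d : ℕ) : Subalgebra k (Laurent k (Fin d)) :=
  ⨅ w : Equiv.Perm (Fin d),
    AlgHom.equalizer (Laurent.rename k w : Laurent k (Fin d) →ₐ[k] Laurent k (Fin d))
      (AlgHom.id k (Laurent k (Fin d)))

/-- `P(c)`: Laurent polynomials in the variables `X_i` for the black positions `i` of `c`. -/
abbrev PolAt (c : J d ℓ) : Type _ := Laurent k c.blacks

variable (d ℓ) in
/-- `P = ⨁_c P(c)`, with componentwise multiplication. -/
abbrev Pol : Type _ := ∀ c : J d ℓ, PolAt k c

/-- A permutation `w` maps the black positions of `w⁻¹ c` bijectively to those of `c`. -/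
def blacksEquiv (w : Equiv.Perm (Fin (ℓ + d))) (c : J d ℓ) :
    (c.permute w⁻¹).blacks ≃ c.blacks :=
  w.subtypeEquiv fun i => by simp [J.blacks, J.permute]

/-- The action of `w ∈ S_{ℓ+d}` on `P`, sending `f ∈ P(c)` to `w(f) ∈ P(w c)`, where `w(X_i) = X_{w i}`.
So the component of `w f` at `c` is the image under `w` of the component of `f` at `w⁻¹ c`. -/
def permutePol (w : Equiv.Perm (Fin (ℓ + d))) : Pol d ℓ k →ₐ[k] Pol d ℓ k :=
  AlgHom.pi fun c =>
    (Laurent.rename k (blacksEquiv w c) :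
      PolAt k (c.permute w⁻¹) →ₐ[k] PolAt k c).comp
      (Pi.evalAlgHom k (fun c : J d ℓ => PolAt k c) (c.permute w⁻¹))

variable (d ℓ) in
/-- The invariants `P^{S_{ℓ+d}}`. -/
def invariantPol : Subalgebra k (Pol d ℓ k) :=
  ⨅ w : Equiv.Perm (Fin (ℓ + d)),
    AlgHom.equalizer (permutePol k w) (AlgHom.id k (Pol d ℓ k))

end Laurent

/-! ### The embeddings into the Hecke algebra -/

section Embedding

variable {k : Type*} [Field k] (q : k) (Q : Fin ℓ → k)

theorem zpowers_xUnit_commute :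
    Pairwise fun s t : Fin d => ∀ a b : Multiplicative ℤ,
      Commute (zpowersHom (Hecke d q Q)ˣ (xUnit q Q s) a)
        (zpowersHom (Hecke d q Q)ˣ (xUnit q Q t) b) := by
  intro s t _ a b
  simpa only [zpowersHom_apply] using (xUnit_commute q Q s t).zpow_zpow a.toAdd b.toAdd

/-- The monomial homomorphism `(a_1, …, a_d) ↦ x_1^{a_1} ⋯ x_d^{a_d}`. -/
def monomialHom : Multiplicative (Fin d → ℤ) →* (Hecke d q Q)ˣ :=
  (MonoidHom.noncommPiCoprod (fun t : Fin d => zpowersHom (Hecke d q Q)ˣ (xUnit q Q t))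
    (zpowers_xUnit_commute q Q)).comp
    (MulEquiv.funMultiplicative (Fin d) ℤ).toMonoidHom

variable (d) in
/-- The diagonal embedding `k[x_1^{±1}, …, x_d^{±1}] → H`, `x_t ↦ ∑_c X_{t_c} e(c)`. -/
def laurentToHecke : Laurent k (Fin d) →ₐ[k] Hecke d q Q :=
  AddMonoidAlgebra.lift k (Hecke d q Q) (Fin d → ℤ)
    ((Units.coeHom (Hecke d q Q)).comp (monomialHom q Q))

theorem e_commute_laurent (c : J d ℓ) (f : Laurent k (Fin d)) :
    laurentToHecke d q Q f * e q Q c = e q Q c * laurentToHecke d q Q f := by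
  have h : ∀ a : Multiplicative (Fin d → ℤ),
      Commute (e q Q c) (monomialHom q Q a : Hecke d q Q) := by
    intro a
    refine Finset.noncommProd_induction _ _ _
      (fun u : (Hecke d q Q)ˣ => Commute (e q Q c) (u : Hecke d q Q)) ?_ ?_ ?_
    · intro u v hu hv
      rw [Units.val_mul]
      exact hu.mul_right hv
    · exact Commute.one_right _
    · intro t _
      rw [zpowersHom_apply]
      exact (e_commute_xUnit q Q c t).units_zpow_right _
  induction f using AddMonoidAlgebra.induction_on with
  | of a =>
    unfold laurentToHecke
    rw [AddMonoidAlgebra.lift_of]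
    exact (h a).symm.eq
  | add f g hf hg => rw [map_add, add_mul, mul_add, hf, hg]
  | smul r f hf => rw [map_smul, smul_mul_assoc, mul_smul_comm, hf]

/-- The embedding `P = ⨁_c P(c) → H` with `P(c) = k[x_1^{±1}, …, x_d^{±1}] e(c)`, under which
`X_i ∈ P(c)` (for `i` black in `c`) goes to `X_i e(c)`. -/
def polToHecke : Pol d ℓ k →ₐ[k] Hecke d q Q :=
  AlgHom.ofLinearMap
    { toFun := fun f => ∑ c : J d ℓ,
        laurentToHecke d q Q (Laurent.rename k c.blackIso.symm.toEquiv (f c)) * e q Q c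
      map_add' := fun f g => by
        simp only [Pi.add_apply, map_add, add_mul, Finset.sum_add_distrib]
      map_smul' := fun a f => by
        simp only [Pi.smul_apply, map_smul, smul_mul_assoc, Finset.smul_sum, RingHom.id_apply] }
    (by simp [sum_e])
    (fun f g => by
      change (∑ c : J d ℓ, _ * e q Q c) = (∑ c : J d ℓ, _ * e q Q c) * (∑ c : J d ℓ, _ * e q Q c)
      rw [sum_mul_sum q Q _ _ fun c => e_commute_laurent q Q c _]
      simp only [Pi.mul_apply, map_mul])

end Embedding

end

end HigherHecke

/-!
The Hecke algebra acts on `⨁_c P(c)` by Demazure–Lusztig operators and transpositions. It is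
convenient to let it act instead on one copy of the field `K` of rational functions in *all* the
variables `X_1, …, X_{ℓ+d}` for each colour sequence `c` (`rep`): the symmetric group then acts on
each copy, and no denominators have to be controlled. On the diagonal part this action is
multiplication by Laurent polynomials (`rep_polToHecke`), so `ι` and `ι_P` are injective.

The main point is that this representation is faithful (`rep_injective`). Since the `T_r` satisfy
the relations of the adjacent transpositions up to terms of lower degree, the products `T_u` for
the standard reduced words `u` of the permutations span the algebra as a left module over its
diagonal part (`IsHeckeLike.normalSpan_eq_top`). Moreover `T_u e(c) = 0` if the permutation of `u`
makes two red entries cross. Fix `b` and `c`, and let `G` be the set of permutations `w` with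
`w(c) = b` that preserve the order of the red entries. Then `e(b) H e(c)` is spanned by at most `|G|`
elements. On the other hand, each `w ∈ G` occurs, up to a nonzero factor, among the operators of
this block (`exists_intertwiner`), and by Dedekind's theorem different automorphisms of `K` are
linearly independent over `K`. Comparing dimensions, the operators of the `T_u` in this block are a
basis of the span of `G` (`blocks_linearIndependent_and_span`), which gives faithfulness without a
computation of leading terms.

A central element `z` has only diagonal blocks. The block of `c` is a `K`-combination of the
elements of `G` for `b = c`, and it commutes with the black variables; as only the identity of `G`
fixes all black positions, the block is a scalar. Comparing coefficients in the basis of the `T_u`,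
the scalar comes from the diagonal part, so `z` is diagonal (`center_le_range`). A diagonal element
commutes with the `T_r` exactly if it is invariant under the adjacent transpositions, hence the
centre consists of the `S_{ℓ+d}`-invariants. Finally, permutations match the black positions of any two
colour sequences in any prescribed way, so an invariant family is given by a single symmetric
Laurent polynomial (`swapInvariant_iff`). As `ι` is injective at every level, the description of
the centre does not depend on the level.
-/

namespace HigherHecke

noncomputable section

/-! ### Laurent polynomials and their field of fractions -/

section Laurent

variable {k : Type*} [Field k]

/-- A homomorphism out of a Laurent polynomial ring is determined by the images of the variables:
monomials with negative exponents are taken care of by uniqueness of inverses. -/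
theorem Laurent.algHom_ext {σ A : Type*} [Fintype σ] [DecidableEq σ] [Semiring A] [Algebra k A]
    {φ ψ : Laurent k σ →ₐ[k] A} (h : ∀ i, φ (Laurent.x k i) = ψ (Laurent.x k i)) : φ = ψ := by
  let S : AddSubgroup (σ → ℤ) :=
    { carrier := {a | φ (AddMonoidAlgebra.single a 1) = ψ (AddMonoidAlgebra.single a 1)}
      zero_mem' := by
        have h1 : (AddMonoidAlgebra.single (0 : σ → ℤ) (1 : k)) = 1 := rfl
        simp only [Set.mem_ofPred_eq, h1, map_one]
      add_mem' := by
        intro a b ha hb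
        have h1 : (AddMonoidAlgebra.single (a + b) (1 : k))
            = AddMonoidAlgebra.single a 1 * AddMonoidAlgebra.single b 1 := by
          rw [AddMonoidAlgebra.single_mul_single, one_mul]
        simp only [Set.mem_ofPred_eq] at *
        rw [h1, map_mul, map_mul, ha, hb]
      neg_mem' := by
        intro a ha
        simp only [Set.mem_ofPred_eq] at *
        have h1 : (AddMonoidAlgebra.single a (1 : k)) * AddMonoidAlgebra.single (-a) 1 = 1 := by
          rw [AddMonoidAlgebra.single_mul_single, one_mul, add_neg_cancel]; rfl
        have h2 : (AddMonoidAlgebra.single (-a) (1 : k)) * AddMonoidAlgebra.single a 1 = 1 := by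
          rw [mul_comm, h1]
        refine left_inv_eq_right_inv (a := φ (AddMonoidAlgebra.single a 1)) ?_ ?_
        · rw [← map_mul, h2, map_one]
        · rw [ha, ← map_mul, h1, map_one] }
  refine AddMonoidAlgebra.algHom_ext (fun a => ?_) ?_
  · have ha : a = ∑ i, a i • (Pi.single i 1 : σ → ℤ) := by
      funext j
      simp [Finset.sum_apply, Pi.single_apply]
    change a ∈ S
    rw [ha]
    exact S.sum_mem fun i _ => S.zsmul_mem (h i) _
  · ext

theorem Laurent.rename_x {σ τ : Type*} [DecidableEq σ] [DecidableEq τ] (w : σ ≃ τ) (i : σ) :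
    Laurent.rename k w (Laurent.x k i) = Laurent.x k (w i) := by
  unfold Laurent.rename Laurent.x
  rw [AddMonoidAlgebra.domCongr_single]
  congr 1
  funext j
  simp [Pi.single_apply, Equiv.symm_apply_eq]

/-- Two injections of a finite set into another differ by a permutation of the target. -/
theorem exists_perm_comp_eq {σ τ : Type*} [Finite τ] {i j : σ → τ}
    (hi : Function.Injective i) (hj : Function.Injective j) :
    ∃ w : Equiv.Perm τ, ∀ s, w (i s) = j s := by
  classical
  let f : {x // x ∈ Set.range i} ≃ {x // x ∈ Set.range j} :=
    (Equiv.ofInjective i hi).symm.trans (Equiv.ofInjective j hj)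
  refine ⟨f.extendSubtype, fun s => ?_⟩
  rw [Equiv.extendSubtype_apply_of_mem f (i s) ⟨s, rfl⟩]
  have : (⟨i s, ⟨s, rfl⟩⟩ : {x // x ∈ Set.range i}) = Equiv.ofInjective i hi s := rfl
  rw [this, Equiv.trans_apply, Equiv.symm_apply_apply]
  rfl

variable (k) in
/-- The field of rational functions in `n` variables, as the field of fractions of the Laurent
polynomial ring. -/
def LaurentField (n : ℕ) : Type _ := FractionRing (Laurent k (Fin n))

variable {n : ℕ}

instance : Field (LaurentField k n) := inferInstanceAs (Field (FractionRing (Laurent k (Fin n))))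

instance : Algebra (Laurent k (Fin n)) (LaurentField k n) :=
  inferInstanceAs (Algebra (Laurent k (Fin n)) (FractionRing (Laurent k (Fin n))))

instance : Algebra k (LaurentField k n) :=
  inferInstanceAs (Algebra k (FractionRing (Laurent k (Fin n))))

instance : IsScalarTower k (Laurent k (Fin n)) (LaurentField k n) :=
  inferInstanceAs (IsScalarTower k (Laurent k (Fin n)) (FractionRing (Laurent k (Fin n))))

instance : IsFractionRing (Laurent k (Fin n)) (LaurentField k n) :=
  inferInstanceAs (IsFractionRing (Laurent k (Fin n)) (FractionRing (Laurent k (Fin n))))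

variable (k) in
/-- The variable `X_i` as a rational function. -/
def fracX (i : Fin n) : LaurentField k n :=
  algebraMap (Laurent k (Fin n)) (LaurentField k n) (Laurent.x k i)

theorem algebraMap_laurentField_injective :
    Function.Injective (algebraMap (Laurent k (Fin n)) (LaurentField k n)) :=
  IsFractionRing.injective _ _

theorem fracX_ne_zero (i : Fin n) : fracX k i ≠ 0 := by
  unfold fracX
  rw [Ne, map_eq_zero_iff _ algebraMap_laurentField_injective]
  unfold Laurent.x
  rw [AddMonoidAlgebra.single_eq_zero]
  exact one_ne_zero

theorem algebraMap_eq_single (a : k) :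
    algebraMap k (Laurent k (Fin n)) a = AddMonoidAlgebra.single 0 a := rfl

/-- Distinct variables are not proportional. -/
theorem algebraMap_mul_fracX_ne (q : k) {i j : Fin n} (hij : i ≠ j) :
    algebraMap k _ q * fracX k i ≠ fracX k j := by
  intro h
  unfold fracX at h
  rw [IsScalarTower.algebraMap_apply k (Laurent k (Fin n)) (LaurentField k n), ← map_mul] at h
  have h1 := algebraMap_laurentField_injective h
  unfold Laurent.x at h1
  rw [algebraMap_eq_single, AddMonoidAlgebra.single_mul_single, zero_add] at h1
  have h2 := congrArg (fun f => AddMonoidAlgebra.coeff f (Pi.single j 1)) h1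
  simp only [AddMonoidAlgebra.coeff_single, Finsupp.single_apply, if_true] at h2
  rw [if_neg] at h2
  · exact zero_ne_one h2
  · intro h3
    have h4 := congrFun h3 i
    rw [Pi.single_eq_same, Pi.single_eq_of_ne hij] at h4
    exact one_ne_zero h4

theorem fracX_ne_algebraMap (a : k) (i : Fin n) : fracX k i ≠ algebraMap k _ a := by
  intro h
  unfold fracX at h
  rw [IsScalarTower.algebraMap_apply k (Laurent k (Fin n)) (LaurentField k n)] at h
  have h1 := algebraMap_laurentField_injective h
  unfold Laurent.x at h1
  rw [algebraMap_eq_single] at h1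
  have h2 := congrArg (fun f => AddMonoidAlgebra.coeff f (Pi.single i 1)) h1
  simp only [AddMonoidAlgebra.coeff_single, Finsupp.single_apply, if_true] at h2
  rw [if_neg] at h2
  · exact one_ne_zero h2
  · intro h3
    have h4 := congrFun h3 i
    rw [Pi.single_eq_same] at h4
    exact zero_ne_one h4

theorem fracX_injective : Function.Injective (fracX k : Fin n → LaurentField k n) := by
  intro i j h
  by_contra hij
  exact algebraMap_mul_fracX_ne (1 : k) hij (by rw [map_one, one_mul, h])

variable (k) in
/-- The symmetric group acts on rational functions by permuting the variables. -/
def act (w : Equiv.Perm (Fin n)) : LaurentField k n ≃ₐ[k] LaurentField k n :=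
  IsFractionRing.algEquivOfAlgEquiv (Laurent.rename k w)

theorem act_algebraMap (w : Equiv.Perm (Fin n)) (f : Laurent k (Fin n)) :
    act k w (algebraMap _ _ f) = algebraMap _ (LaurentField k n) (Laurent.rename k w f) :=
  IsFractionRing.algEquivOfAlgEquiv_algebraMap _ _

@[simp]
theorem act_fracX (w : Equiv.Perm (Fin n)) (i : Fin n) :
    act k w (fracX k i) = fracX k (w i) := by
  unfold fracX
  rw [act_algebraMap, Laurent.rename_x]

/-- Endomorphisms of the field of rational functions are determined by the images of the
variables. -/
theorem algHom_laurentField_ext {φ ψ : LaurentField k n →ₐ[k] LaurentField k n}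
    (h : ∀ i, φ (fracX k i) = ψ (fracX k i)) : φ = ψ := by
  have h1 : φ.comp (IsScalarTower.toAlgHom k (Laurent k (Fin n)) (LaurentField k n))
      = ψ.comp (IsScalarTower.toAlgHom k (Laurent k (Fin n)) (LaurentField k n)) :=
    Laurent.algHom_ext fun i => h i
  have h2 : (φ : LaurentField k n →+* LaurentField k n) = ψ :=
    IsLocalization.ringHom_ext (nonZeroDivisors (Laurent k (Fin n)))
      (RingHom.ext fun f => DFunLike.congr_fun h1 f)
  exact AlgHom.ext fun f => RingHom.congr_fun h2 f

theorem act_act (v w : Equiv.Perm (Fin n)) (f : LaurentField k n) :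
    act k v (act k w f) = act k (v * w) f := by
  have h : (act k v : LaurentField k n →ₐ[k] LaurentField k n).comp (act k w : _ →ₐ[k] _)
      = (act k (v * w) : LaurentField k n →ₐ[k] LaurentField k n) :=
    algHom_laurentField_ext fun i => by simp
  exact DFunLike.congr_fun h f

@[simp]
theorem act_one (f : LaurentField k n) : act k 1 f = f := by
  have h : (act k (1 : Equiv.Perm (Fin n)) : LaurentField k n →ₐ[k] LaurentField k n) = AlgHom.id k _ :=
    algHom_laurentField_ext fun i => by simp
  exact DFunLike.congr_fun h f

theorem act_injective : Function.Injective (act k : Equiv.Perm (Fin n) → LaurentField k n ≃ₐ[k] _) := by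
  intro v w h
  refine Equiv.ext fun i => fracX_injective (k := k) ?_
  rw [← act_fracX, ← act_fracX, h]

/-- The permutations of the variables are linearly independent over the field of rational
functions. -/
theorem linearIndependent_act :
    LinearIndependent (LaurentField k n)
      (fun w : Equiv.Perm (Fin n) => (fun f => act k w f : LaurentField k n → LaurentField k n)) := by
  have h := (linearIndependent_monoidHom (LaurentField k n) (LaurentField k n)).comp
    (fun w : Equiv.Perm (Fin n) => ((act k w : LaurentField k n ≃ₐ[k] _) : LaurentField k n →* _)) ?_
  · exact h
  · intro v w hvw
    exact act_injective (AlgEquiv.ext fun f => DFunLike.congr_fun hvw f)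

/-- The embedding of a Laurent polynomial ring into the field of rational functions given by an
injection of its variables into `{X_1, …, X_n}`. -/
def embed {σ : Type*} (j : σ → Fin n) : Laurent k σ →ₐ[k] LaurentField k n :=
  (IsScalarTower.toAlgHom k (Laurent k (Fin n)) (LaurentField k n)).comp
    (AddMonoidAlgebra.mapDomainAlgHom k k (Function.ExtendByZero.hom ℤ j))

theorem embed_injective {σ : Type*} {j : σ → Fin n} (hj : Function.Injective j) :
    Function.Injective (embed (k := k) j) := by
  refine algebraMap_laurentField_injective.comp (AddMonoidAlgebra.mapDomain_injective ?_)
  intro a b hab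
  funext s
  have h := congrFun hab (j s)
  simpa [Function.ExtendByZero.hom, hj.extend_apply] using h

theorem embed_x {σ : Type*} [DecidableEq σ] {j : σ → Fin n} (hj : Function.Injective j) (s : σ) :
    embed (k := k) j (Laurent.x k s) = fracX k (j s) := by
  unfold embed fracX
  rw [AlgHom.comp_apply]
  change algebraMap (Laurent k (Fin n)) (LaurentField k n) _ = _
  congr 1
  unfold Laurent.x
  rw [AddMonoidAlgebra.mapDomainAlgHom_apply, AddMonoidAlgebra.mapDomain_single]
  congr 1
  funext i
  change Function.extend j _ 0 i = _
  by_cases h : ∃ t, j t = i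
  · obtain ⟨t, rfl⟩ := h
    rw [hj.extend_apply]
    simp only [Pi.single_apply, hj.eq_iff]
  · rw [Function.extend_apply' _ _ _ h, Pi.single_eq_of_ne fun h' => h ⟨s, h'.symm⟩]
    rfl

theorem embed_rename {σ τ : Type*} [Fintype σ] [DecidableEq σ] [DecidableEq τ] {j : τ → Fin n}
    (hj : Function.Injective j) (w : σ ≃ τ) (f : Laurent k σ) :
    embed j (Laurent.rename k w f) = embed (j ∘ w) f := by
  have h : (embed j).comp (Laurent.rename k w : Laurent k σ →ₐ[k] Laurent k τ)
      = embed (j ∘ w) :=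
    Laurent.algHom_ext fun i => by
      rw [embed_x (hj.comp w.injective), AlgHom.comp_apply]
      change embed j (Laurent.rename k w _) = _
      rw [Laurent.rename_x, embed_x hj, Function.comp_apply]
  exact DFunLike.congr_fun h f

theorem act_embed {σ : Type*} [Fintype σ] [DecidableEq σ] {j : σ → Fin n}
    (hj : Function.Injective j) (w : Equiv.Perm (Fin n)) (f : Laurent k σ) :
    act k w (embed j f) = embed (w ∘ j) f := by
  have h : (act k w : LaurentField k n →ₐ[k] _).comp (embed j) = embed (w ∘ j) :=
    Laurent.algHom_ext fun i => by
      rw [embed_x (w.injective.comp hj), AlgHom.comp_apply, embed_x hj]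
      exact act_fracX w (j i)
  exact DFunLike.congr_fun h f

end Laurent

/-! ### Normal words -/

section NormalWords

/-- The descending word `m - 1, m - 2, …, j`, with `n` letters, where `m = j + n`. -/
def descend (j : ℕ) : ℕ → List ℕ
  | 0 => []
  | n + 1 => descend (j + 1) n ++ [j]

/-- The normal words in the letters `0, …, m - 2`: the standard reduced words of the permutations
of `m` points, built from the cosets of the permutations of `m - 1` points. -/
def normalWords : ℕ → Set (List ℕ)
  | 0 => {[]}
  | m + 1 => {w | ∃ u ∈ normalWords m, ∃ j n, j + n = m ∧ w = u ++ descend j n}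

theorem nil_mem_normalWords : ∀ m, [] ∈ normalWords m
  | 0 => rfl
  | m + 1 => ⟨[], nil_mem_normalWords m, m, 0, rfl, rfl⟩

theorem lt_of_mem_descend {r : ℕ} : ∀ {n j : ℕ}, r ∈ descend j n → j ≤ r ∧ r < j + n
  | 0, j, h => by simp [descend] at h
  | n + 1, j, h => by
    rcases List.mem_append.1 h with h | h
    · have := lt_of_mem_descend h
      omega
    · have := List.mem_singleton.1 h
      omega

theorem lt_of_mem_normalWords {r : ℕ} :
    ∀ {m : ℕ} {w : List ℕ}, w ∈ normalWords m → r ∈ w → r + 1 < m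
  | 0, w, hw, hr => by
    rw [show w = [] from hw] at hr
    simp at hr
  | m + 1, w, ⟨u, hu, j, n, hjn, hw⟩, hr => by
    rw [hw] at hr
    rcases List.mem_append.1 hr with h | h
    · have := lt_of_mem_normalWords hu h
      omega
    · have := lt_of_mem_descend h
      omega

variable {k H : Type*} [Field k] [Semiring H] [Algebra k H]

/-- The product of the elements indexed by a word. -/
def wordProd {M : Type*} [Monoid M] (T : ℕ → M) (w : List ℕ) : M := (w.map T).prod

section

variable {M : Type*} [Monoid M] (T : ℕ → M)

@[simp]
theorem wordProd_nil : wordProd T [] = 1 := rfl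

theorem wordProd_append (u v : List ℕ) : wordProd T (u ++ v) = wordProd T u * wordProd T v := by
  simp [wordProd]

@[simp]
theorem wordProd_cons (r : ℕ) (u : List ℕ) : wordProd T (r :: u) = T r * wordProd T u := by
  simp [wordProd]

theorem wordProd_singleton (r : ℕ) : wordProd T [r] = T r := by simp [wordProd]

theorem wordProd_descend_succ (j n : ℕ) :
    wordProd T (descend j (n + 1)) = wordProd T (descend (j + 1) n) * T j := by
  rw [descend, wordProd_append, wordProd_singleton]

theorem wordProd_descend_append (j n n' : ℕ) :
    wordProd T (descend j (n' + n))
      = wordProd T (descend (j + n') n) * wordProd T (descend j n') := by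
  induction n' generalizing j with
  | zero => simp [descend]
  | succ n' ih =>
    rw [show n' + 1 + n = (n' + n) + 1 by omega, wordProd_descend_succ, ih, wordProd_descend_succ,
      mul_assoc, show j + 1 + n' = j + (n' + 1) by omega]

/-- A letter far from all letters of a word commutes with the product of the word. -/
theorem commute_wordProd {r : ℕ} {w : List ℕ} (h : ∀ s ∈ w, T r * T s = T s * T r) :
    T r * wordProd T w = wordProd T w * T r := by
  induction w with
  | nil => simp
  | cons s w ih =>
    rw [wordProd_cons, ← mul_assoc, h s (by simp), mul_assoc, ih fun x hx => h x (by simp [hx]),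
      mul_assoc]

end

/-- An algebra with a subalgebra `P` and elements `T_0, T_1, …` that satisfy the relations of the
simple transpositions up to terms of lower degree in the `T_r` with coefficients in `P`. -/
structure IsHeckeLike (P : Subalgebra k H) (T : ℕ → H) : Prop where
  comm : ∀ r s, r + 1 < s → T r * T s = T s * T r
  move : ∀ r, ∀ p ∈ P, ∃ a ∈ P, ∃ b ∈ P, T r * p = a * T r + b
  sq : ∀ r, ∃ a ∈ P, ∃ b ∈ P, T r * T r = a * T r + b
  braid : ∀ r, ∃ b ∈ P, T (r + 1) * T r * T (r + 1) = T r * T (r + 1) * T r + b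

variable (P : Subalgebra k H) (T : ℕ → H)

/-- The left `P`-span of the normal words in the letters `0, …, m - 2`. -/
def normalSpan (m : ℕ) : Submodule P H := Submodule.span P (wordProd T '' normalWords m)

/-- The left `P`-span of the products of normal words in the letters `0, …, m - 2` with the
descending words `m - 1, …, j'` for `j' ≥ j`. -/
def cosetSpan (m j : ℕ) : Submodule P H :=
  Submodule.span P {x | ∃ u ∈ normalWords m, ∃ j' n, j ≤ j' ∧ j' + n = m ∧
    x = wordProd T u * wordProd T (descend j' n)}

theorem normalSpan_succ (m : ℕ) : normalSpan P T (m + 1) = cosetSpan P T m 0 := by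
  unfold normalSpan cosetSpan
  congr 1
  ext x
  constructor
  · rintro ⟨w, ⟨u, hu, j, n, hjn, rfl⟩, rfl⟩
    exact ⟨u, hu, j, n, Nat.zero_le _, hjn, wordProd_append T _ _⟩
  · rintro ⟨u, hu, j, n, -, hjn, rfl⟩
    exact ⟨u ++ descend j n, ⟨u, hu, j, n, hjn, rfl⟩, wordProd_append T _ _⟩

variable {P T}

theorem cosetSpan_anti {m j j' : ℕ} (h : j ≤ j') : cosetSpan P T m j' ≤ cosetSpan P T m j :=
  Submodule.span_mono fun _ ⟨u, hu, i, n, hi, hin, hx⟩ => ⟨u, hu, i, n, h.trans hi, hin, hx⟩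

theorem mul_descend_mem_cosetSpan {m j j' n : ℕ} (hj : j ≤ j') (hn : j' + n = m) {x : H}
    (hx : x ∈ normalSpan P T m) : x * wordProd T (descend j' n) ∈ cosetSpan P T m j := by
  induction hx using Submodule.span_induction with
  | mem x hx =>
    obtain ⟨u, hu, rfl⟩ := hx
    exact Submodule.subset_span ⟨u, hu, j', n, hj, hn, rfl⟩
  | zero => rw [zero_mul]; exact Submodule.zero_mem _
  | add x y _ _ hx hy => rw [add_mul]; exact Submodule.add_mem _ hx hy
  | smul a x _ hx => rw [smul_mul_assoc]; exact Submodule.smul_mem _ a hx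

/-- To check that right multiplication by `h` maps a coset span into a submodule, it is enough to
look at products with a descending word. -/
theorem cosetSpan_mul_mem {m j : ℕ} {h : H} {V : Submodule P H}
    (H' : ∀ x ∈ normalSpan P T m, ∀ j' n, j ≤ j' → j' + n = m →
      x * wordProd T (descend j' n) * h ∈ V) {x : H} (hx : x ∈ cosetSpan P T m j) :
    x * h ∈ V := by
  induction hx using Submodule.span_induction with
  | mem x hx =>
    obtain ⟨u, hu, j', n, hj, hn, rfl⟩ := hx
    exact H' _ (Submodule.subset_span ⟨u, hu, rfl⟩) j' n hj hn
  | zero => rw [zero_mul]; exact Submodule.zero_mem _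
  | add x y _ _ hx hy => rw [add_mul]; exact Submodule.add_mem _ hx hy
  | smul a x _ hx => rw [smul_mul_assoc]; exact Submodule.smul_mem _ a hx

namespace IsHeckeLike

variable (hT : IsHeckeLike P T)

include hT

theorem commute_descend {i j n : ℕ} (h : i + 1 < j) :
    T i * wordProd T (descend j n) = wordProd T (descend j n) * T i :=
  commute_wordProd T fun s hs => hT.comm i s (by have := lt_of_mem_descend hs; omega)

section Step

variable {m : ℕ} (ihP : ∀ x ∈ normalSpan P T m, ∀ p ∈ P, x * p ∈ normalSpan P T m)
  (ihT : ∀ x ∈ normalSpan P T m, ∀ r, r + 1 < m → x * T r ∈ normalSpan P T m)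

include ihT

theorem cosetSpan_mul_far {i j : ℕ} (h : i + 1 < j) {x : H} (hx : x ∈ cosetSpan P T m j) :
    x * T i ∈ cosetSpan P T m j := by
  refine cosetSpan_mul_mem (fun x hx j' n hj hn => ?_) hx
  rw [mul_assoc, ← hT.commute_descend (by omega : i + 1 < j'), ← mul_assoc]
  exact mul_descend_mem_cosetSpan hj hn (ihT x hx i (by omega))

theorem cosetSpan_mul_pred {j : ℕ} {x : H} (hx : x ∈ cosetSpan P T m (j + 1)) :
    x * T j ∈ cosetSpan P T m j := by
  refine cosetSpan_mul_mem (fun x hx j' n hj hn => ?_) hx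
  rcases Nat.eq_or_lt_of_le hj with rfl | hj'
  · rw [mul_assoc, ← wordProd_descend_succ]
    exact mul_descend_mem_cosetSpan le_rfl (by omega) hx
  · rw [mul_assoc, ← hT.commute_descend hj', ← mul_assoc]
    exact mul_descend_mem_cosetSpan (by omega) hn (ihT x hx j (by omega))

theorem cosetSpan_mul_word {i j n : ℕ} (h : j + n < i) {x : H} (hx : x ∈ cosetSpan P T m i) :
    x * wordProd T (descend j n) ∈ cosetSpan P T m i := by
  induction n generalizing j x with
  | zero => simpa [descend] using hx
  | succ n ih =>
    rw [wordProd_descend_succ, ← mul_assoc]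
    exact hT.cosetSpan_mul_far ihT (by omega) (ih (by omega) hx)

include ihP

theorem cosetSpan_mul_diag {n : ℕ} : ∀ {j : ℕ}, j + n = m → ∀ {x : H}, x ∈ cosetSpan P T m j →
    ∀ p ∈ P, x * p ∈ cosetSpan P T m j := by
  induction n with
  | zero =>
    intro j hj x hx p hp
    refine cosetSpan_mul_mem (fun x hx j' n hj' hn => ?_) hx
    obtain rfl : n = 0 := by omega
    have h := mul_descend_mem_cosetSpan (j := j) hj' hn (ihP x hx p hp)
    simpa [descend] using h
  | succ n ih =>
    intro j hj x hx p hp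
    have ih' : ∀ {x : H}, x ∈ cosetSpan P T m (j + 1) → ∀ p ∈ P, x * p ∈ cosetSpan P T m (j + 1) :=
      fun hx => ih (by omega) hx
    refine cosetSpan_mul_mem (fun x hx j' n' hj' hn => ?_) hx
    rcases Nat.eq_or_lt_of_le hj' with rfl | hlt
    · obtain rfl : n' = n + 1 := by omega
      obtain ⟨a, ha, b, hb, hab⟩ := hT.move j p hp
      have hy := mul_descend_mem_cosetSpan (j := j + 1) le_rfl (by omega : j + 1 + n = m) hx
      rw [wordProd_descend_succ, mul_assoc, mul_assoc, hab, mul_add, mul_add, ← mul_assoc,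
        ← mul_assoc, ← mul_assoc]
      exact Submodule.add_mem _ (hT.cosetSpan_mul_pred ihT (ih' hy a ha))
        (cosetSpan_anti (Nat.le_succ j) (ih' hy b hb))
    · exact cosetSpan_anti (Nat.le_succ j) (ih' (mul_descend_mem_cosetSpan hlt hn hx) p hp)

/-- The only case in which the braid relation is needed is that of a letter inside the range of a
descending word. -/
theorem cosetSpan_mul_letter {r : ℕ} (hr : r < m) {x : H} (hx : x ∈ cosetSpan P T m 0) :
    x * T r ∈ cosetSpan P T m 0 := by
  refine cosetSpan_mul_mem (fun x hx j n _ hn => ?_) hx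
  rcases lt_trichotomy r j with hrj | rfl | hrj
  · rcases Nat.eq_or_lt_of_le hrj with rfl | hlt
    · rw [mul_assoc, ← wordProd_descend_succ]
      exact mul_descend_mem_cosetSpan (Nat.zero_le _) (by omega) hx
    · exact cosetSpan_anti (Nat.zero_le j)
        (hT.cosetSpan_mul_far ihT hlt (mul_descend_mem_cosetSpan le_rfl hn hx))
  · obtain ⟨n, rfl⟩ : ∃ n', n = n' + 1 := ⟨n - 1, by omega⟩
    obtain ⟨a, ha, b, hb, hab⟩ := hT.sq r
    have hy := mul_descend_mem_cosetSpan (j := r + 1) le_rfl (by omega : r + 1 + n = m) hx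
    have hP := fun p hp => hT.cosetSpan_mul_diag ihP ihT (by omega : r + 1 + n = m) hy p hp
    rw [wordProd_descend_succ, mul_assoc, mul_assoc, hab, mul_add, mul_add, ← mul_assoc,
      ← mul_assoc, ← mul_assoc]
    exact Submodule.add_mem _
      (cosetSpan_anti (Nat.zero_le _) (hT.cosetSpan_mul_pred ihT (hP a ha)))
      (cosetSpan_anti (Nat.zero_le _) (hP b hb))
  · obtain ⟨i, rfl⟩ : ∃ i, r = j + i + 1 := ⟨r - j - 1, by omega⟩
    obtain ⟨n, rfl⟩ : ∃ n', n = i + (1 + (1 + n')) := ⟨n - i - 2, by omega⟩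
    obtain ⟨b, hb, hbr⟩ := hT.braid (j + i)
    -- Write `C` for the descending word down to `r + 1` and `W` for the one from `r - 2` to `j`.
    have hC : wordProd T (descend j (i + (1 + (1 + n))))
        = wordProd T (descend (j + i + 1 + 1) n) * (T (j + i + 1) * T (j + i))
          * wordProd T (descend j i) := by
      rw [wordProd_descend_append, wordProd_descend_append, wordProd_descend_append]
      simp [descend, mul_assoc]
    have hW : T (j + i + 1) * wordProd T (descend j i)
        = wordProd T (descend j i) * T (j + i + 1) :=
      commute_wordProd T fun s hs =>
        (hT.comm s (j + i + 1) (by have := lt_of_mem_descend hs; omega)).symm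
    have hfar := hT.commute_descend (i := j + i) (j := j + i + 1 + 1) (n := n) (by omega)
    have key : wordProd T (descend j (i + (1 + (1 + n)))) * T (j + i + 1)
        = T (j + i) * wordProd T (descend j (i + (1 + (1 + n))))
          + wordProd T (descend (j + i + 1 + 1) n) * b * wordProd T (descend j i) := by
      rw [hC]
      calc _ = wordProd T (descend (j + i + 1 + 1) n) * (T (j + i + 1) * T (j + i)) *
            (wordProd T (descend j i) * T (j + i + 1)) := by simp only [mul_assoc]
        _ = wordProd T (descend (j + i + 1 + 1) n) * (T (j + i + 1) * T (j + i) * T (j + i + 1)) *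
            wordProd T (descend j i) := by rw [← hW]; simp only [mul_assoc]
        _ = (wordProd T (descend (j + i + 1 + 1) n) * T (j + i)) * (T (j + i + 1) * T (j + i)) *
            wordProd T (descend j i)
            + wordProd T (descend (j + i + 1 + 1) n) * b * wordProd T (descend j i) := by
              rw [hbr]; simp only [mul_add, add_mul, mul_assoc]
        _ = _ := by rw [← hfar]; simp only [mul_assoc]
    rw [mul_assoc, key, mul_add, ← mul_assoc, ← mul_assoc, ← mul_assoc]
    refine Submodule.add_mem _
      (mul_descend_mem_cosetSpan (Nat.zero_le _) hn (ihT x hx _ (by omega))) ?_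
    refine cosetSpan_anti (Nat.zero_le (j + i + 1 + 1)) ?_
    exact hT.cosetSpan_mul_word ihT (by omega) (hT.cosetSpan_mul_diag ihP ihT
      (by omega : j + i + 1 + 1 + n = m) (mul_descend_mem_cosetSpan le_rfl (by omega) hx) b hb)

end Step

theorem normalSpan_mul_mem (m : ℕ) :
    (∀ x ∈ normalSpan P T m, ∀ p ∈ P, x * p ∈ normalSpan P T m) ∧
    ∀ x ∈ normalSpan P T m, ∀ r, r + 1 < m → x * T r ∈ normalSpan P T m := by
  induction m with
  | zero =>
    refine ⟨fun x hx p hp => ?_, fun x hx r hr => absurd hr (by omega)⟩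
    have h0 : normalSpan P T 0 = Submodule.span P {1} := by
      unfold normalSpan normalWords
      rw [Set.image_singleton, wordProd_nil]
    rw [h0] at hx ⊢
    obtain ⟨a, rfl⟩ := Submodule.mem_span_singleton.1 hx
    refine Submodule.mem_span_singleton.2 ⟨a * ⟨p, hp⟩, ?_⟩
    rw [Subalgebra.smul_def, Subalgebra.smul_def]
    simp
  | succ m ih =>
    rw [normalSpan_succ]
    exact ⟨fun x hx p hp => hT.cosetSpan_mul_diag ih.1 ih.2 (zero_add m) hx p hp,
      fun x hx r hr => hT.cosetSpan_mul_letter ih.1 ih.2 (by omega) hx⟩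

/-- If `P` and `T_0, …, T_{m-2}` generate the algebra, then the normal words span it as a left
`P`-module. -/
theorem normalSpan_eq_top (m : ℕ) (hm : ∀ r, m ≤ r + 1 → T r = 0)
    (hgen : Algebra.adjoin k ((P : Set H) ∪ Set.range T) = ⊤) : normalSpan P T m = ⊤ := by
  obtain ⟨hP, hT'⟩ := hT.normalSpan_mul_mem m
  have key : ∀ h : H, ∀ x ∈ normalSpan P T m, x * h ∈ normalSpan P T m := by
    intro h
    have hh : h ∈ Algebra.adjoin k ((P : Set H) ∪ Set.range T) := hgen ▸ Algebra.mem_top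
    induction hh using Algebra.adjoin_induction with
    | mem y hy =>
      intro x hx
      rcases hy with hy | ⟨r, rfl⟩
      · exact hP x hx y hy
      · by_cases hr : r + 1 < m
        · exact hT' x hx r hr
        · rw [hm r (by omega), mul_zero]
          exact Submodule.zero_mem _
    | algebraMap a => exact fun x hx => hP x hx _ (P.algebraMap_mem a)
    | add y z _ _ hy hz => exact fun x hx => mul_add x y z ▸ Submodule.add_mem _ (hy x hx) (hz x hx)
    | mul y z _ _ hy hz => exact fun x hx => mul_assoc x y z ▸ hz _ (hy x hx)
  rw [eq_top_iff]
  intro h _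
  have h1 : (1 : H) ∈ normalSpan P T m :=
    Submodule.subset_span ⟨[], nil_mem_normalWords m, wordProd_nil T⟩
  simpa using key h 1 h1

end IsHeckeLike

end NormalWords

/-! ### Permuting colour sequences -/

section Colours

variable {d ℓ : ℕ}

theorem J.permute_apply (w : Equiv.Perm (Fin (ℓ + d))) (c : J d ℓ) (i) :
    (c.permute w).1 i = c.1 (w⁻¹ i) := rfl

@[simp]
theorem J.permute_apply_apply (w : Equiv.Perm (Fin (ℓ + d))) (c : J d ℓ) (i) :
    (c.permute w).1 (w i) = c.1 i := by
  rw [J.permute_apply]; simp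

@[simp]
theorem J.permute_permute (v w : Equiv.Perm (Fin (ℓ + d))) (c : J d ℓ) :
    (c.permute w).permute v = c.permute (v * w) :=
  Subtype.ext (funext fun i => by simp [J.permute_apply, mul_inv_rev])

@[simp]
theorem J.permute_one (c : J d ℓ) : c.permute 1 = c := rfl

theorem J.colour_eq_one_iff (c : J d ℓ) (i) : c.1 i = 1 ↔ ¬ c.1 i = 0 := by
  generalize c.1 i = x
  fin_cases x <;> simp

theorem J.ext_black {b c : J d ℓ} (h : ∀ i, b.1 i = 0 ↔ c.1 i = 0) : b = c := by
  refine Subtype.ext (funext fun i => ?_)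
  by_cases hb : b.1 i = 0
  · rw [hb, (h i).1 hb]
  · rw [(b.colour_eq_one_iff i).2 hb, (c.colour_eq_one_iff i).2 fun hc => hb ((h i).2 hc)]

/-- It is enough to compare black positions in one direction, since all colour sequences have the
same number `d` of them. -/
theorem J.eq_of_black_imp {b c : J d ℓ} (h : ∀ i, b.1 i = 0 → c.1 i = 0) : b = c := by
  have h1 : b.blacks = c.blacks := by
    refine Finset.eq_of_subset_of_card_le (fun i hi => ?_) (by rw [b.card_blacks, c.card_blacks])
    simp only [J.blacks, Finset.mem_filter, Finset.mem_univ, true_and] at *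
    exact h i hi
  refine J.ext_black fun i => ?_
  have := Finset.ext_iff.1 h1 i
  simpa [J.blacks] using this

theorem J.permute_swap_of_eq {c : J d ℓ} {a b : Fin (ℓ + d)} (h : c.1 a = c.1 b) :
    c.permute (Equiv.swap a b) = c := by
  refine Subtype.ext (funext fun i => ?_)
  rw [J.permute_apply, Equiv.swap_inv, Equiv.swap_apply_def]
  split_ifs with h1 h2
  · rw [h1, h]
  · rw [h2, h]
  · rfl

theorem J.permute_swap_left (c : J d ℓ) (a b : Fin (ℓ + d)) :
    (c.permute (Equiv.swap a b)).1 a = c.1 b := by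
  rw [J.permute_apply, Equiv.swap_inv, Equiv.swap_apply_left]

theorem J.permute_swap_right (c : J d ℓ) (a b : Fin (ℓ + d)) :
    (c.permute (Equiv.swap a b)).1 b = c.1 a := by
  rw [J.permute_apply, Equiv.swap_inv, Equiv.swap_apply_right]

theorem J.permute_swap_of_ne (c : J d ℓ) {a b i : Fin (ℓ + d)} (ha : i ≠ a) (hb : i ≠ b) :
    (c.permute (Equiv.swap a b)).1 i = c.1 i := by
  rw [J.permute_apply, Equiv.swap_inv, Equiv.swap_apply_of_ne_of_ne ha hb]

@[simp]
theorem J.permute_swap_swap (c : J d ℓ) (a b : Fin (ℓ + d)) :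
    (c.permute (Equiv.swap a b)).permute (Equiv.swap a b) = c := by
  rw [J.permute_permute, Equiv.swap_mul_self, J.permute_one]

theorem J.permute_injective (w : Equiv.Perm (Fin (ℓ + d))) :
    Function.Injective (J.permute w : J d ℓ → J d ℓ) := by
  intro b c h
  have := congrArg (J.permute w⁻¹) h
  simpa using this

/-- There is a colour sequence: first `ℓ` red entries, then `d` black ones. -/
instance J.instNonempty : Nonempty (J d ℓ) := by
  refine ⟨⟨Fin.append (fun _ => 1) (fun _ => 0), ?_⟩⟩
  rw [Fin.sum_univ_add]
  simp

variable {k : Type*} [Field k]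

/-- The parameter attached to the red entry at position `i`; zero if the entry is black. -/
def param (Q : Fin ℓ → k) (c : J d ℓ) (i : Fin (ℓ + d)) : k :=
  if h : c.1 i = 1 then Q (c.redIndex i h) else 0

theorem param_of_red (Q : Fin ℓ → k) (c : J d ℓ) (i : Fin (ℓ + d)) (h : c.1 i = 1) :
    param Q c i = Q (c.redIndex i h) := dif_pos h

/-- The parameter travels with the red entry when two adjacent entries are swapped, as long as red
entries do not cross. -/
theorem param_permute_swap (Q : Fin ℓ → k) (c : J d ℓ) {a b : Fin (ℓ + d)}
    (hab : (b : ℕ) = a + 1) (h : c.1 a = 0 ∨ c.1 b = 0) (i : Fin (ℓ + d)) :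
    param Q (c.permute (Equiv.swap a b)) (Equiv.swap a b i) = param Q c i := by
  unfold param
  have h1 := c.permute_apply_apply (Equiv.swap a b) i
  by_cases hi : c.1 i = 1
  · rw [dif_pos (h1.trans hi), dif_pos hi]
    congr 1
    refine Fin.ext ?_
    simp only [J.redIndex, Finset.sum_filter]
    rw [← Equiv.sum_comp (Equiv.swap a b)]
    refine Finset.sum_congr rfl fun j _ => ?_
    rw [J.permute_apply_apply]
    by_cases hj : c.1 j = 0
    · simp [hj]
    have key : Equiv.swap a b j < Equiv.swap a b i ↔ j < i := by
      have hij : ¬ (i = a ∧ j = b) := by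
        rintro ⟨rfl, rfl⟩
        rw [hi] at h
        simp [hj] at h
      have hij' : ¬ (i = b ∧ j = a) := by
        rintro ⟨rfl, rfl⟩
        rw [hi] at h
        simp [hj] at h
      rw [Equiv.swap_apply_def, Equiv.swap_apply_def]
      simp only [Fin.ext_iff, Fin.lt_def] at *
      split_ifs <;> omega
    simp only [key]
  · rw [dif_neg (fun h' => hi (h1.symm.trans h')), dif_neg hi]

theorem lo_ne_hi (r : ℕ) (hr : r + 1 < ℓ + d) : lo r hr ≠ hi r hr := by
  simp [Fin.ext_iff]

end Colours

/-! ### The polynomial representation over the field of rational functions -/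

section Representation

variable {d ℓ : ℕ} {k : Type*} [Field k]

variable (d ℓ k) in
/-- The representation space: one copy of the field of rational functions in `X_1, …, X_{ℓ+d}` for
each colour sequence. The variables at red positions are present so that the symmetric group acts
on each copy. -/
abbrev RepSpace : Type _ := J d ℓ →₀ LaurentField k (ℓ + d)

/-- Multiplication by a rational function in each component. -/
def diagOp : (J d ℓ → LaurentField k (ℓ + d)) →ₐ[k] Module.End k (RepSpace d ℓ k) :=
  AlgHom.ofLinearMap
    { toFun := fun χ => Finsupp.lsum k fun c =>
        (Finsupp.lsingle c).comp (LinearMap.mulLeft k (χ c))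
      map_add' := fun χ ψ => by
        refine Finsupp.lhom_ext fun c f => ?_
        simp [add_mul]
      map_smul' := fun a χ => by
        refine Finsupp.lhom_ext fun c f => ?_
        simp }
    (by
      refine Finsupp.lhom_ext fun c f => ?_
      simp)
    (fun χ ψ => by
      refine Finsupp.lhom_ext fun c f => ?_
      simp [-Finsupp.single_mul])

@[simp]
theorem diagOp_single (χ : J d ℓ → LaurentField k (ℓ + d)) (c : J d ℓ) (f) :
    diagOp χ (Finsupp.single c f) = Finsupp.single c (χ c * f) := by
  simp [diagOp]

theorem diagOp_apply (χ : J d ℓ → LaurentField k (ℓ + d)) (F : RepSpace d ℓ k) (b : J d ℓ) :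
    diagOp χ F b = χ b * F b := by
  classical
  induction F using Finsupp.induction_linear with
  | zero => simp
  | add F G hF hG => rw [map_add, Finsupp.add_apply, hF, hG, Finsupp.add_apply, mul_add]
  | single c f =>
    rw [diagOp_single, Finsupp.single_apply, Finsupp.single_apply]
    split_ifs with h
    · rw [h]
    · rw [mul_zero]

/-- The operator of `e(c)`: the projection to a component. -/
def opE (c : J d ℓ) : Module.End k (RepSpace d ℓ k) := diagOp (Pi.single c 1)

/-- The operator of `X_i`. -/
def opX (i : Fin (ℓ + d)) : Module.End k (RepSpace d ℓ k) :=
  diagOp fun c => if c.1 i = 0 then fracX k i else 0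

/-- The operator of `X'_i`. -/
def opX' (i : Fin (ℓ + d)) : Module.End k (RepSpace d ℓ k) :=
  diagOp fun c => if c.1 i = 0 then (fracX k i)⁻¹ else 0

/-- The scalar part of the operator of `T_r` for `(a, b) = (r, r + 1)`; it is nonzero only for two
black entries. -/
def coeffA (q : k) (a b : Fin (ℓ + d)) (c : J d ℓ) : LaurentField k (ℓ + d) :=
  if c.1 a = 0 ∧ c.1 b = 0 then
    (algebraMap k _ q - 1) * fracX k b / (fracX k b - fracX k a) else 0

/-- The coefficient of the transposition in the operator of `T_r` for `(a, b) = (r, r + 1)`. -/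
def coeffB (q : k) (Q : Fin ℓ → k) (a b : Fin (ℓ + d)) (c : J d ℓ) : LaurentField k (ℓ + d) :=
  if c.1 a = 0 then
    if c.1 b = 0 then
      (fracX k b - algebraMap k _ q * fracX k a) / (fracX k b - fracX k a)
    else 1
  else if c.1 b = 0 then fracX k a - algebraMap k _ (param Q c a) else 0

/-- The operator of `T_r` for `(a, b) = (r, r + 1)`: a Demazure–Lusztig operator on two black
entries, a transposition (with a factor in one of the two directions) if a red and a black entry
cross, and zero on two red entries. -/
def opT (q : k) (Q : Fin ℓ → k) (a b : Fin (ℓ + d)) : Module.End k (RepSpace d ℓ k) :=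
  Finsupp.lsum k fun c =>
    (Finsupp.lsingle c).comp (LinearMap.mulLeft k (coeffA q a b c)) +
    (Finsupp.lsingle (c.permute (Equiv.swap a b))).comp
      ((LinearMap.mulLeft k (coeffB q Q a b c)).comp
        (act k (Equiv.swap a b)).toLinearMap)

variable (q : k) (Q : Fin ℓ → k)

theorem opT_single (a b : Fin (ℓ + d)) (c : J d ℓ) (f) :
    opT q Q a b (Finsupp.single c f) = Finsupp.single c (coeffA q a b c * f) +
      Finsupp.single (c.permute (Equiv.swap a b))
        (coeffB q Q a b c * act k (Equiv.swap a b) f) := by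
  simp [opT]

theorem opT_single_black {a b : Fin (ℓ + d)} {c : J d ℓ} (ha : c.1 a = 0) (hb : c.1 b = 0) (f) :
    opT q Q a b (Finsupp.single c f) = Finsupp.single c
      ((algebraMap k _ q - 1) * fracX k b / (fracX k b - fracX k a) * f
        + (fracX k b - algebraMap k _ q * fracX k a) / (fracX k b - fracX k a)
          * act k (Equiv.swap a b) f) := by
  rw [opT_single, J.permute_swap_of_eq (ha.trans hb.symm), ← Finsupp.single_add, coeffA, coeffB,
    if_pos ⟨ha, hb⟩, if_pos ha, if_pos hb]

theorem opT_single_black_red {a b : Fin (ℓ + d)} {c : J d ℓ} (ha : c.1 a = 0) (hb : c.1 b = 1)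
    (f) : opT q Q a b (Finsupp.single c f) =
      Finsupp.single (c.permute (Equiv.swap a b)) (act k (Equiv.swap a b) f) := by
  rw [opT_single, coeffA, coeffB]
  simp [ha, hb]

theorem opT_single_red_black {a b : Fin (ℓ + d)} {c : J d ℓ} (ha : c.1 a = 1) (hb : c.1 b = 0)
    (f) : opT q Q a b (Finsupp.single c f) =
      Finsupp.single (c.permute (Equiv.swap a b))
        ((fracX k a - algebraMap k _ (param Q c a)) * act k (Equiv.swap a b) f) := by
  rw [opT_single, coeffA, coeffB]
  simp [ha, hb]

theorem opT_single_red {a b : Fin (ℓ + d)} {c : J d ℓ} (ha : c.1 a = 1) (hb : c.1 b = 1) (f) :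
    opT q Q a b (Finsupp.single c f) = 0 := by
  rw [opT_single, coeffA, coeffB]
  simp [ha, hb]

theorem opE_single_self (c : J d ℓ) (f : LaurentField k (ℓ + d)) :
    opE c (Finsupp.single c f) = Finsupp.single c f := by
  simp [opE]

theorem opE_single_of_ne {b c : J d ℓ} (h : b ≠ c) (f : LaurentField k (ℓ + d)) :
    opE c (Finsupp.single b f) = 0 := by
  simp [opE, h]

/-- Two operators agree after multiplication by `e(c)` on the right if they agree on the component
of `c`. -/
theorem mul_opE_eq {c : J d ℓ} {A B : Module.End k (RepSpace d ℓ k)}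
    (h : ∀ f, A (Finsupp.single c f) = B (Finsupp.single c f)) : A * opE c = B * opE c := by
  refine Finsupp.lhom_ext fun b f => ?_
  rw [Module.End.mul_apply, Module.End.mul_apply]
  by_cases hbc : b = c
  · subst hbc
    rw [opE_single_self, h]
  · rw [opE_single_of_ne hbc, map_zero, map_zero]

theorem fracX_sub_ne_zero {i j : Fin (ℓ + d)} (h : i ≠ j) : fracX k i - fracX k j ≠ 0 :=
  sub_ne_zero.2 fun h' => h (fracX_injective h')

theorem act_swap_swap (a b : Fin (ℓ + d)) (f) :
    act k (Equiv.swap a b) (act k (Equiv.swap a b) f) = f := by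
  rw [act_act, Equiv.swap_mul_self, act_one]

theorem coeffA_permute {a b a' b' : Fin (ℓ + d)} (h : a ≠ a' ∧ a ≠ b' ∧ b ≠ a' ∧ b ≠ b')
    (c : J d ℓ) : coeffA q a b (c.permute (Equiv.swap a' b')) = coeffA q a b c := by
  unfold coeffA
  rw [J.permute_swap_of_ne c h.1 h.2.1, J.permute_swap_of_ne c h.2.2.1 h.2.2.2]

theorem act_coeffA {a b a' b' : Fin (ℓ + d)} (h : a ≠ a' ∧ a ≠ b' ∧ b ≠ a' ∧ b ≠ b')
    (c : J d ℓ) : act k (Equiv.swap a' b') (coeffA q a b c) = coeffA q a b c := by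
  unfold coeffA
  split_ifs
  · simp [Equiv.swap_apply_of_ne_of_ne h.1 h.2.1, Equiv.swap_apply_of_ne_of_ne h.2.2.1 h.2.2.2]
  · simp

theorem act_coeffB {a b a' b' : Fin (ℓ + d)} (h : a ≠ a' ∧ a ≠ b' ∧ b ≠ a' ∧ b ≠ b')
    (c : J d ℓ) : act k (Equiv.swap a' b') (coeffB q Q a b c) = coeffB q Q a b c := by
  unfold coeffB
  split_ifs <;>
  simp [Equiv.swap_apply_of_ne_of_ne h.1 h.2.1, Equiv.swap_apply_of_ne_of_ne h.2.2.1 h.2.2.2]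

theorem coeffB_permute_mul {a b a' b' : Fin (ℓ + d)} (h : a ≠ a' ∧ a ≠ b' ∧ b ≠ a' ∧ b ≠ b')
    (hab' : (b' : ℕ) = a' + 1) (c : J d ℓ) :
    coeffB q Q a b (c.permute (Equiv.swap a' b')) * coeffB q Q a' b' c
      = coeffB q Q a b c * coeffB q Q a' b' c := by
  by_cases hred : c.1 a' = 0 ∨ c.1 b' = 0
  · congr 1
    unfold coeffB
    have h1 := param_permute_swap Q c hab' hred a
    rw [Equiv.swap_apply_of_ne_of_ne h.1 h.2.1] at h1
    rw [J.permute_swap_of_ne c h.1 h.2.1, J.permute_swap_of_ne c h.2.2.1 h.2.2.2, h1]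
  · have : coeffB q Q a' b' c = 0 := by
      unfold coeffB
      rw [not_or] at hred
      rw [if_neg hred.1, if_neg hred.2]
    rw [this, mul_zero, mul_zero]

/-- Operators at disjoint pairs of adjacent positions commute. -/
theorem opT_comm {a b a' b' : Fin (ℓ + d)} (h : a ≠ a' ∧ a ≠ b' ∧ b ≠ a' ∧ b ≠ b')
    (hab : (b : ℕ) = a + 1) (hab' : (b' : ℕ) = a' + 1) :
    opT q Q a b * opT q Q a' b' = opT q Q a' b' * opT q Q a b := by
  have h' : a' ≠ a ∧ a' ≠ b ∧ b' ≠ a ∧ b' ≠ b :=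
    ⟨h.1.symm, h.2.2.1.symm, h.2.1.symm, h.2.2.2.symm⟩
  have hs : Equiv.swap a b * Equiv.swap a' b' = Equiv.swap a' b' * Equiv.swap a b := by
    refine Equiv.Perm.Disjoint.commute (Equiv.Perm.disjoint_iff_disjoint_support.2 ?_)
    have e1 : a ≠ b := fun h => by rw [h] at hab; omega
    have e2 : a' ≠ b' := fun h => by rw [h] at hab'; omega
    rw [Equiv.Perm.support_swap e1, Equiv.Perm.support_swap e2]
    simp [h'.1, h'.2.1, h'.2.2.1, h'.2.2.2]
  refine Finsupp.lhom_ext fun c f => ?_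
  have hB1 := coeffB_permute_mul q Q h hab' c
  have hB2 := coeffB_permute_mul q Q h' hab c
  simp only [Module.End.mul_apply, opT_single, map_add, map_mul, act_coeffA q h, act_coeffA q h',
    act_coeffB q Q h, act_coeffB q Q h', coeffA_permute q h, coeffA_permute q h',
    J.permute_permute, act_act, hs]
  rw [← mul_assoc, ← mul_assoc, ← mul_assoc, ← mul_assoc, ← mul_assoc, ← mul_assoc, ← mul_assoc,
    ← mul_assoc, hB1, hB2]
  simp only [mul_comm (coeffA q a b c), mul_comm (coeffB q Q a b c)]
  abel

end Representation

section Braid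

variable {d ℓ : ℕ} {k : Type*} [Field k] (q : k) (Q : Fin ℓ → k)

theorem swap_braid {α : Type*} [DecidableEq α] {a b c : α} (hab : a ≠ b) (hbc : b ≠ c)
    (hac : a ≠ c) : Equiv.swap a b * (Equiv.swap b c * Equiv.swap a b)
      = Equiv.swap b c * (Equiv.swap a b * Equiv.swap b c) := by
  ext i
  simp only [Equiv.Perm.mul_apply, Equiv.swap_apply_def]
  split_ifs <;> simp_all

/-- The quadratic relation on two black entries. -/
theorem opT_sq_black {a b : Fin (ℓ + d)} (hab : a ≠ b) {c : J d ℓ} (ha : c.1 a = 0)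
    (hb : c.1 b = 0) (f) :
    opT q Q a b (opT q Q a b (Finsupp.single c f)) =
      (q - 1) • opT q Q a b (Finsupp.single c f) + q • Finsupp.single c f := by
  have h1 := fracX_sub_ne_zero (k := k) hab
  have h2 := fracX_sub_ne_zero (k := k) hab.symm
  rw [opT_single_black q Q ha hb, opT_single_black q Q ha hb, Finsupp.smul_single,
    Finsupp.smul_single, ← Finsupp.single_add]
  congr 1
  simp only [map_add, map_mul, map_sub, map_div₀, act_fracX, act_swap_swap, AlgEquiv.commutes,
    map_one, Equiv.swap_apply_left, Equiv.swap_apply_right, Algebra.smul_def]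
  generalize act k (Equiv.swap a b) f = g
  field_simp
  ring

theorem opT_braid_black {a b e : Fin (ℓ + d)} (hab : a ≠ b) (hbe : b ≠ e) (hae : a ≠ e)
    {c : J d ℓ} (ha : c.1 a = 0) (hb : c.1 b = 0) (he : c.1 e = 0) (f) :
    opT q Q a b (opT q Q b e (opT q Q a b (Finsupp.single c f))) =
      opT q Q b e (opT q Q a b (opT q Q b e (Finsupp.single c f))) := by
  have h1 := fracX_sub_ne_zero (k := k) hab
  have h2 := fracX_sub_ne_zero (k := k) hab.symm
  have h3 := fracX_sub_ne_zero (k := k) hbe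
  have h4 := fracX_sub_ne_zero (k := k) hbe.symm
  have h5 := fracX_sub_ne_zero (k := k) hae
  have h6 := fracX_sub_ne_zero (k := k) hae.symm
  simp only [opT_single_black q Q ha hb, opT_single_black q Q hb he]
  congr 1
  simp only [map_add, map_mul, map_sub, map_div₀, act_fracX, act_swap_swap, AlgEquiv.commutes,
    map_one, Equiv.swap_apply_left, Equiv.swap_apply_right,
    Equiv.swap_apply_of_ne_of_ne hae.symm hbe.symm, Equiv.swap_apply_of_ne_of_ne hab hae]
  have hbr : act k (Equiv.swap a b) (act k (Equiv.swap b e) (act k (Equiv.swap a b) f))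
      = act k (Equiv.swap b e) (act k (Equiv.swap a b) (act k (Equiv.swap b e) f)) := by
    simp only [act_act, swap_braid hab hbe hae]
  rw [hbr]
  generalize act k (Equiv.swap b e) (act k (Equiv.swap a b) (act k (Equiv.swap b e) f)) = g1
  generalize act k (Equiv.swap a b) (act k (Equiv.swap b e) f) = g2
  generalize act k (Equiv.swap b e) (act k (Equiv.swap a b) f) = g3
  generalize act k (Equiv.swap a b) f = g4
  generalize act k (Equiv.swap b e) f = g5
  generalize (algebraMap k (LaurentField k (ℓ + d))) q = q'
  generalize fracX k a = x at *
  generalize fracX k b = y at *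
  generalize fracX k e = z at *
  field_simp
  ring

/-- The braid relation with a black entry in the middle. -/
theorem opT_braid {a b e : Fin (ℓ + d)} (hab : (b : ℕ) = a + 1) (hbe : (e : ℕ) = b + 1)
    {c : J d ℓ} (hb : c.1 b = 0) (f) :
    opT q Q a b (opT q Q b e (opT q Q a b (Finsupp.single c f))) =
      opT q Q b e (opT q Q a b (opT q Q b e (Finsupp.single c f))) := by
  have nab : a ≠ b := fun h => by rw [h] at hab; omega
  have nbe : b ≠ e := fun h => by rw [h] at hbe; omega
  have nae : a ≠ e := fun h => by rw [← h, hab] at hbe; omega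
  have hbr : act k (Equiv.swap a b) (act k (Equiv.swap b e) (act k (Equiv.swap a b) f))
      = act k (Equiv.swap b e) (act k (Equiv.swap a b) (act k (Equiv.swap b e) f)) := by
    simp only [act_act, swap_braid nab nbe nae]
  have h1 := fracX_sub_ne_zero (k := k) nab
  have h2 := fracX_sub_ne_zero (k := k) nab.symm
  have h3 := fracX_sub_ne_zero (k := k) nbe
  have h4 := fracX_sub_ne_zero (k := k) nbe.symm
  have sa : Equiv.swap b e a = a := Equiv.swap_apply_of_ne_of_ne nab nae
  have se : Equiv.swap a b e = e := Equiv.swap_apply_of_ne_of_ne nae.symm nbe.symm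
  by_cases ha : c.1 a = 0
  · by_cases he : c.1 e = 0
    · exact opT_braid_black q Q nab nbe nae ha hb he f
    · -- black, black, red
      have he1 := (c.colour_eq_one_iff e).2 he
      have c1a : (c.permute (Equiv.swap b e)).1 a = 0 := by rw [c.permute_swap_of_ne nab nae, ha]
      have c1b : (c.permute (Equiv.swap b e)).1 b = 1 := by rw [c.permute_swap_left, he1]
      have c1e : (c.permute (Equiv.swap b e)).1 e = 0 := by rw [c.permute_swap_right, hb]
      set c1 := c.permute (Equiv.swap b e) with hc1
      have c2b : (c1.permute (Equiv.swap a b)).1 b = 0 := by rw [c1.permute_swap_right, c1a]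
      have c2e : (c1.permute (Equiv.swap a b)).1 e = 0 := by
        rw [c1.permute_swap_of_ne nae.symm nbe.symm, c1e]
      rw [opT_single_black q Q ha hb, opT_single_black_red q Q hb he1,
        opT_single_black_red q Q hb he1, ← hc1, opT_single_black_red q Q c1a c1b,
        opT_single_black_red q Q c1a c1b, opT_single_black q Q c2b c2e]
      congr 1
      simp only [map_add, map_mul, map_sub, map_div₀, act_fracX, AlgEquiv.commutes,
        map_one, Equiv.swap_apply_left, sa, se, hbr]
  · have ha1 := (c.colour_eq_one_iff a).2 ha
    have c1a : (c.permute (Equiv.swap a b)).1 a = 0 := by rw [c.permute_swap_left, hb]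
    have c1b : (c.permute (Equiv.swap a b)).1 b = 1 := by rw [c.permute_swap_right, ha1]
    have c1e : (c.permute (Equiv.swap a b)).1 e = c.1 e := by
      rw [c.permute_swap_of_ne nae.symm nbe.symm]
    by_cases he : c.1 e = 0
    · -- red, black, black
      rw [he] at c1e
      have p1 := param_permute_swap Q c hab (Or.inr hb) a
      rw [Equiv.swap_apply_left] at p1
      rw [opT_single_black q Q hb he, opT_single_red_black q Q ha1 hb,
        opT_single_red_black q Q ha1 hb]
      set c1 := c.permute (Equiv.swap a b) with hc1
      have c2a : (c1.permute (Equiv.swap b e)).1 a = 0 := by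
        rw [c1.permute_swap_of_ne nab nae, c1a]
      have c2b : (c1.permute (Equiv.swap b e)).1 b = 0 := by rw [c1.permute_swap_left, c1e]
      rw [opT_single_red_black q Q c1b c1e, opT_single_red_black q Q c1b c1e,
        opT_single_black q Q c2a c2b, p1]
      congr 1
      simp only [map_add, map_mul, map_sub, map_div₀, act_fracX, AlgEquiv.commutes,
        map_one, Equiv.swap_apply_left, Equiv.swap_apply_right, sa, se, hbr]
      ring
    · -- red, black, red
      have he1 := (c.colour_eq_one_iff e).2 he
      rw [he1] at c1e
      have c3a : (c.permute (Equiv.swap b e)).1 a = 1 := by rw [c.permute_swap_of_ne nab nae, ha1]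
      have c3b : (c.permute (Equiv.swap b e)).1 b = 1 := by rw [c.permute_swap_left, he1]
      rw [opT_single_red_black q Q ha1 hb, opT_single_red q Q c1b c1e, map_zero,
        opT_single_black_red q Q hb he1, opT_single_red q Q c3a c3b, map_zero]

/-- The braid relation with a red entry between two black ones. -/
theorem opT_braid_red {a b e : Fin (ℓ + d)} (hab : (b : ℕ) = a + 1) (hbe : (e : ℕ) = b + 1)
    {c : J d ℓ} (ha : c.1 a = 0) (hb : c.1 b = 1) (he : c.1 e = 0) (f) :
    opT q Q a b (opT q Q b e (opT q Q a b (Finsupp.single c f))) -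
      opT q Q b e (opT q Q a b (opT q Q b e (Finsupp.single c f))) =
    (1 - q) • Finsupp.single c (fracX k e * f) := by
  have nab : a ≠ b := fun h => by rw [h] at hab; omega
  have nbe : b ≠ e := fun h => by rw [h] at hbe; omega
  have nae : a ≠ e := fun h => by rw [← h, hab] at hbe; omega
  have hbr : act k (Equiv.swap a b) (act k (Equiv.swap b e) (act k (Equiv.swap a b) f))
      = act k (Equiv.swap b e) (act k (Equiv.swap a b) (act k (Equiv.swap b e) f)) := by
    simp only [act_act, swap_braid nab nbe nae]
  have h5 := fracX_sub_ne_zero (k := k) nae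
  have h6 := fracX_sub_ne_zero (k := k) nae.symm
  have sa : Equiv.swap b e a = a := Equiv.swap_apply_of_ne_of_ne nab nae
  have se : Equiv.swap a b e = e := Equiv.swap_apply_of_ne_of_ne nae.symm nbe.symm
  have c1a : (c.permute (Equiv.swap a b)).1 a = 1 := by rw [c.permute_swap_left, hb]
  have c1b : (c.permute (Equiv.swap a b)).1 b = 0 := by rw [c.permute_swap_right, ha]
  have c1e : (c.permute (Equiv.swap a b)).1 e = 0 := by
    rw [c.permute_swap_of_ne nae.symm nbe.symm, he]
  have c2a : (c.permute (Equiv.swap b e)).1 a = 0 := by rw [c.permute_swap_of_ne nab nae, ha]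
  have c2b : (c.permute (Equiv.swap b e)).1 b = 0 := by rw [c.permute_swap_left, he]
  have c2e : (c.permute (Equiv.swap b e)).1 e = 1 := by rw [c.permute_swap_right, hb]
  have p1 := param_permute_swap Q c hab (Or.inl ha) b
  rw [Equiv.swap_apply_right] at p1
  have p2 := param_permute_swap Q c hbe (Or.inr he) b
  rw [Equiv.swap_apply_left] at p2
  rw [opT_single_black_red q Q ha hb, opT_single_red_black q Q hb he, opT_single_black q Q c1b c1e,
    opT_single_black q Q c2a c2b, opT_single_red_black q Q c1a c1b,
    opT_single_black_red q Q c2b c2e, J.permute_swap_swap, J.permute_swap_swap, p1,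
    Finsupp.smul_single, ← Finsupp.single_sub]
  congr 1
  simp only [map_add, map_mul, map_sub, map_div₀, act_fracX, AlgEquiv.commutes, act_swap_swap,
    map_one, Equiv.swap_apply_left, Equiv.swap_apply_right, sa, se, hbr, Algebra.smul_def]
  generalize act k (Equiv.swap b e) (act k (Equiv.swap a b) (act k (Equiv.swap b e) f)) = g1
  generalize (algebraMap k (LaurentField k (ℓ + d))) q = q'
  generalize (algebraMap k (LaurentField k (ℓ + d))) (param Q c b) = r
  generalize fracX k a = x at *
  generalize fracX k e = z at *
  field_simp
  ring

end Braid

section Phi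

variable {d ℓ : ℕ} {k : Type*} [Field k] (q : k) (Q : Fin ℓ → k)

/-- The operators of the generators. -/
def opGen : Gen d ℓ → Module.End k (RepSpace d ℓ k)
  | Gen.e c => opE c
  | Gen.T r hr => opT q Q (lo r hr) (hi r hr)
  | Gen.X i => opX i
  | Gen.X' i => opX' i

@[simp]
theorem opX_single (i : Fin (ℓ + d)) (c : J d ℓ) (f : LaurentField k (ℓ + d)) :
    opX i (Finsupp.single c f) = Finsupp.single c ((if c.1 i = 0 then fracX k i else 0) * f) :=
  diagOp_single _ _ _

@[simp]
theorem opX'_single (i : Fin (ℓ + d)) (c : J d ℓ) (f : LaurentField k (ℓ + d)) :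
    opX' i (Finsupp.single c f)
      = Finsupp.single c ((if c.1 i = 0 then (fracX k i)⁻¹ else 0) * f) :=
  diagOp_single _ _ _

theorem mul_opE_eq' {c : J d ℓ} {A B : Module.End k (RepSpace d ℓ k)}
    (hB : B * opE c = B) (h : ∀ f, A (Finsupp.single c f) = B (Finsupp.single c f)) :
    A * opE c = B := hB ▸ mul_opE_eq h

theorem mul_opE_eq_of_vanish {c : J d ℓ} {A B : Module.End k (RepSpace d ℓ k)}
    (hB : ∀ b ≠ c, ∀ f, B (Finsupp.single b f) = 0)
    (h : ∀ f, A (Finsupp.single c f) = B (Finsupp.single c f)) : A * opE c = B := by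
  refine Finsupp.lhom_ext fun b f => ?_
  rw [Module.End.mul_apply]
  by_cases hbc : b = c
  · subst hbc
    rw [opE_single_self, h]
  · rw [opE_single_of_ne hbc, map_zero, hB b hbc]

theorem opE_mul_opE (c : J d ℓ) : (opE c * opE c : Module.End k (RepSpace d ℓ k)) = opE c := by
  unfold opE
  rw [← map_mul]
  congr 1
  funext b
  by_cases h : b = c
  · subst h; simp
  · simp [h]

theorem diagOp_comm (χ ψ : J d ℓ → LaurentField k (ℓ + d)) :
    diagOp χ * diagOp ψ = diagOp ψ * diagOp χ := by
  rw [← map_mul, mul_comm, map_mul]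

theorem opT_mul_opE (a b : Fin (ℓ + d)) (c : J d ℓ) :
    opT q Q a b * opE c = opE (c.permute (Equiv.swap a b)) * opT q Q a b := by
  refine Finsupp.lhom_ext fun c' f => ?_
  rw [Module.End.mul_apply, Module.End.mul_apply, opT_single, map_add]
  by_cases hc : c' = c
  · subst hc
    rw [opE_single_self, opE_single_self, opT_single]
    congr 1
    by_cases h : c'.1 a = 0 ∧ c'.1 b = 0
    · rw [J.permute_swap_of_eq (h.1.trans h.2.symm), opE_single_self]
    · simp [coeffA, h]
  · rw [opE_single_of_ne hc, map_zero,
      opE_single_of_ne fun h => hc (J.permute_injective _ h), add_zero]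
    by_cases h : c'.1 a = 0 ∧ c'.1 b = 0
    · have h1 := J.permute_swap_of_eq (h.1.trans h.2.symm)
      rw [opE_single_of_ne]
      intro h2
      rw [← h1] at h2
      exact hc (J.permute_injective _ h2)
    · simp [coeffA, h]

set_option maxHeartbeats 1000000 in
/-- The operators satisfy the defining relations of the Hecke algebra. -/
theorem opGen_rel {x y : FreeAlgebra k (Gen d ℓ)} (h : Rel q Q x y) :
    FreeAlgebra.lift k (opGen q Q) x = FreeAlgebra.lift k (opGen q Q) y := by
  cases h with
  | e_sum =>
    simp only [map_sum, FreeAlgebra.lift_ι_apply, map_one, opGen, opE]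
    rw [← map_sum, ← map_one diagOp]
    congr 1
    funext c
    simp [Finset.sum_apply, Pi.single_apply]
  | e_idem c => simpa [opGen] using opE_mul_opE c
  | X_red i c h =>
    simp only [map_mul, FreeAlgebra.lift_ι_apply, opGen, map_zero]
    exact mul_opE_eq' (by simp) fun f => by simp [h]
  | X'_red i c h =>
    simp only [map_mul, FreeAlgebra.lift_ι_apply, opGen, map_zero]
    exact mul_opE_eq' (by simp) fun f => by simp [h]
  | X_X' i c h =>
    simp only [map_mul, FreeAlgebra.lift_ι_apply, opGen]
    exact mul_opE_eq' (opE_mul_opE c) fun f => by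
      rw [Module.End.mul_apply, opX'_single, opX_single, opE_single_self, if_pos h, if_pos h,
        mul_inv_cancel_left₀ (fracX_ne_zero i)]
  | X'_X i c h =>
    simp only [map_mul, FreeAlgebra.lift_ι_apply, opGen]
    exact mul_opE_eq' (opE_mul_opE c) fun f => by
      rw [Module.End.mul_apply, opX_single, opX'_single, opE_single_self, if_pos h, if_pos h,
        inv_mul_cancel_left₀ (fracX_ne_zero i)]
  | X_e i c =>
    simp only [map_mul, FreeAlgebra.lift_ι_apply, opGen]
    exact diagOp_comm _ _
  | X'_e i c =>
    simp only [map_mul, FreeAlgebra.lift_ι_apply, opGen]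
    exact diagOp_comm _ _
  | X_comm i j =>
    simp only [map_mul, FreeAlgebra.lift_ι_apply, opGen]
    exact diagOp_comm _ _
  | X'_comm i j =>
    simp only [map_mul, FreeAlgebra.lift_ι_apply, opGen]
    exact diagOp_comm _ _
  | T_comm r s hr hs h =>
    simp only [map_mul, FreeAlgebra.lift_ι_apply, opGen]
    refine opT_comm q Q ?_ rfl rfl
    simp only [Ne, Fin.ext_iff]
    omega
  | T_X_comm r hr i h0 h1 =>
    simp only [map_mul, FreeAlgebra.lift_ι_apply, opGen]
    refine Finsupp.lhom_ext fun c f => ?_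
    rw [Module.End.mul_apply, Module.End.mul_apply, opX_single, opT_single, opT_single, map_add,
      opX_single, opX_single, J.permute_swap_of_ne c h0 h1]
    split_ifs with h
    · simp only [map_mul, act_fracX, Equiv.swap_apply_of_ne_of_ne h0 h1]
      rw [mul_left_comm (coeffA _ _ _ _), mul_left_comm (coeffB _ _ _ _ _)]
    · simp
  | T_red r hr c h0 h1 =>
    simp only [map_mul, FreeAlgebra.lift_ι_apply, opGen, map_zero]
    exact mul_opE_eq' (by simp) fun f => by rw [opT_single_red q Q h0 h1]; rfl
  | T_e r hr c =>
    simp only [map_mul, FreeAlgebra.lift_ι_apply, opGen]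
    exact opT_mul_opE q Q _ _ c
  | T_X_hi_black r hr c h0 h1 =>
    simp only [map_mul, map_sub, map_smul, FreeAlgebra.lift_ι_apply, opGen]
    rw [← smul_mul_assoc]
    refine mul_opE_eq fun f => ?_
    have h2 := fracX_sub_ne_zero (k := k) (lo_ne_hi r hr).symm
    simp only [LinearMap.sub_apply, LinearMap.smul_apply, Module.End.mul_apply, opX_single,
      opT_single_black q Q h0 h1, if_pos h0, if_pos h1, map_mul, act_fracX,
      Equiv.swap_apply_right, Finsupp.smul_single, ← Finsupp.single_sub]
    congr 1
    rw [Algebra.smul_def, map_sub, map_one]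
    field_simp
    ring
  | T_X_hi_red r hr c h =>
    simp only [map_mul, map_sub, FreeAlgebra.lift_ι_apply, opGen, map_zero]
    refine mul_opE_eq' (by simp) fun f => ?_
    have h3 : coeffA (k := k) q (lo r hr) (hi r hr) c = 0 := if_neg h
    simp only [LinearMap.sub_apply, Module.End.mul_apply, opX_single, opT_single, h3, zero_mul,
      Finsupp.single_zero, zero_add, J.permute_swap_left, LinearMap.zero_apply]
    split_ifs
    · rw [map_mul, act_fracX, Equiv.swap_apply_right, mul_left_comm, sub_self]
    · simp
  | T_X_lo_black r hr c h0 h1 =>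
    simp only [map_mul, map_sub, map_neg, map_smul, FreeAlgebra.lift_ι_apply, opGen]
    refine mul_opE_eq_of_vanish (fun b hb f => by
      simp only [LinearMap.neg_apply, LinearMap.smul_apply, Module.End.mul_apply,
        opE_single_of_ne hb, map_zero, smul_zero, neg_zero]) fun f => ?_
    have h2 := fracX_sub_ne_zero (k := k) (lo_ne_hi r hr).symm
    simp only [LinearMap.sub_apply, LinearMap.neg_apply, LinearMap.smul_apply,
      Module.End.mul_apply, opE_single_self, opX_single,
      opT_single_black q Q h0 h1, if_pos h0, if_pos h1, map_mul, act_fracX,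
      Equiv.swap_apply_left, Finsupp.smul_single, ← Finsupp.single_sub, ← Finsupp.single_neg]
    congr 1
    rw [Algebra.smul_def, map_sub, map_one]
    field_simp
    ring
  | T_X_lo_red r hr c h =>
    simp only [map_mul, map_sub, FreeAlgebra.lift_ι_apply, opGen, map_zero]
    refine mul_opE_eq' (by simp) fun f => ?_
    have h3 : coeffA (k := k) q (lo r hr) (hi r hr) c = 0 := if_neg h
    simp only [LinearMap.sub_apply, Module.End.mul_apply, opX_single, opT_single, h3, zero_mul,
      Finsupp.single_zero, zero_add, J.permute_swap_right, LinearMap.zero_apply]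
    split_ifs
    · rw [map_mul, act_fracX, Equiv.swap_apply_left, mul_left_comm, sub_self]
    · simp
  | T_sq_black r hr c h0 h1 =>
    simp only [map_mul, map_add, map_smul, FreeAlgebra.lift_ι_apply, opGen]
    rw [← smul_mul_assoc]
    have h2 : q • (opE c : Module.End k (RepSpace d ℓ k)) = (q • 1) * opE c := by
      rw [smul_mul_assoc, one_mul]
    rw [h2, ← add_mul]
    refine mul_opE_eq fun f => ?_
    exact opT_sq_black q Q (lo_ne_hi r hr) h0 h1 f
  | T_sq_black_red r hr c h0 h1 =>
    simp only [map_mul, map_sub, map_smul, FreeAlgebra.lift_ι_apply, opGen]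
    refine mul_opE_eq_of_vanish (fun b hb f => by
      simp only [LinearMap.sub_apply, LinearMap.smul_apply, Module.End.mul_apply,
        opE_single_of_ne hb, map_zero, smul_zero, sub_zero]) fun f => ?_
    rw [← param_of_red Q c (hi r hr) h1]
    have p1 := param_permute_swap Q c (a := lo r hr) (b := hi r hr) rfl (Or.inl h0) (hi r hr)
    rw [Equiv.swap_apply_right] at p1
    rw [Module.End.mul_apply, opT_single_black_red q Q h0 h1,
      opT_single_red_black q Q (by rw [J.permute_swap_left, h1])
        (by rw [J.permute_swap_right, h0]), J.permute_swap_swap, p1, act_swap_swap,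
      LinearMap.sub_apply, Module.End.mul_apply, LinearMap.smul_apply, opE_single_self, opX_single,
      if_pos h0,
      Finsupp.smul_single, ← Finsupp.single_sub, Algebra.smul_def, sub_mul]
  | T_sq_red_black r hr c h0 h1 =>
    simp only [map_mul, map_sub, map_smul, FreeAlgebra.lift_ι_apply, opGen]
    refine mul_opE_eq_of_vanish (fun b hb f => by
      simp only [LinearMap.sub_apply, LinearMap.smul_apply, Module.End.mul_apply,
        opE_single_of_ne hb, map_zero, smul_zero, sub_zero]) fun f => ?_
    rw [← param_of_red Q c (lo r hr) h0]
    rw [Module.End.mul_apply, opT_single_red_black q Q h0 h1,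
      opT_single_black_red q Q (by rw [J.permute_swap_left, h1])
        (by rw [J.permute_swap_right, h0]), J.permute_swap_swap, map_mul, act_swap_swap,
      LinearMap.sub_apply, Module.End.mul_apply, LinearMap.smul_apply, opE_single_self, opX_single,
      if_pos h1,
      Finsupp.smul_single, ← Finsupp.single_sub, Algebra.smul_def, map_sub, act_fracX,
      Equiv.swap_apply_left, AlgEquiv.commutes, sub_mul]
  | braid r hr hr' c h =>
    simp only [map_mul, map_sub, FreeAlgebra.lift_ι_apply, opGen, map_zero]
    refine mul_opE_eq' (by simp) fun f => ?_
    simp only [LinearMap.sub_apply, Module.End.mul_apply, LinearMap.zero_apply]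
    exact sub_eq_zero.2 (opT_braid q Q rfl rfl h f)
  | braid_red r hr hr' c h0 h1 h2 =>
    simp only [map_mul, map_sub, map_smul, FreeAlgebra.lift_ι_apply, opGen]
    rw [← smul_mul_assoc]
    refine mul_opE_eq fun f => ?_
    simp only [LinearMap.sub_apply, Module.End.mul_apply, LinearMap.smul_apply, opX_single,
      if_pos h2]
    exact opT_braid_red q Q rfl rfl h0 h1 h2 f

variable (d) in
/-- The polynomial representation of the Hecke algebra, with coefficients extended to rational
functions. -/
def rep : Hecke d q Q →ₐ[k] Module.End k (RepSpace d ℓ k) :=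
  RingQuot.liftAlgHom k ⟨FreeAlgebra.lift k (opGen q Q), fun _ _ h => opGen_rel q Q h⟩

theorem rep_e (c : J d ℓ) : rep d q Q (e q Q c) = opE c := by
  simp [rep, e, opGen]

theorem rep_T (r : ℕ) (hr : r + 1 < ℓ + d) :
    rep d q Q (T q Q r hr) = opT q Q (lo r hr) (hi r hr) := by
  simp [rep, T, opGen]

theorem rep_X (i : Fin (ℓ + d)) : rep d q Q (X q Q i) = opX i := by
  simp [rep, X, opGen]

end Phi

/-! ### The diagonal part of the Hecke algebra -/

section Diagonal

variable {d ℓ : ℕ} {k : Type*} [Field k] (q : k) (Q : Fin ℓ → k)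

theorem laurentToHecke_x (t : Fin d) :
    laurentToHecke d q Q (Laurent.x k t) = xUnit q Q t := by
  unfold laurentToHecke Laurent.x
  rw [AddMonoidAlgebra.lift_single, one_smul]
  change ((MonoidHom.noncommPiCoprod _ (zpowers_xUnit_commute q Q)
    (Pi.mulSingle t (Multiplicative.ofAdd 1)) : (Hecke d q Q)ˣ) : Hecke d q Q) = _
  rw [MonoidHom.noncommPiCoprod_mulSingle, zpowersHom_apply]
  simp

theorem J.pos_injective (c : J d ℓ) : Function.Injective c.pos :=
  Subtype.val_injective.comp c.blackIso.injective

/-- The operators of the diagonal elements `x_t`. -/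
theorem rep_laurentToHecke (f : Laurent k (Fin d)) :
    rep d q Q (laurentToHecke d q Q f) = diagOp fun c => embed c.pos f := by
  have h : (rep d q Q).comp (laurentToHecke d q Q)
      = diagOp.comp (AlgHom.pi fun c : J d ℓ => embed (k := k) c.pos) := by
    refine Laurent.algHom_ext fun t => ?_
    rw [AlgHom.comp_apply, AlgHom.comp_apply, laurentToHecke_x]
    change rep d q Q (∑ c : J d ℓ, X q Q (c.pos t) * e q Q c) = _
    refine Finsupp.lhom_ext fun b f => ?_
    rw [map_sum, LinearMap.sum_apply, Finset.sum_eq_single b]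
    · rw [map_mul, rep_X, rep_e, Module.End.mul_apply, opE_single_self, opX_single,
        if_pos (b.pos_black t), diagOp_single, AlgHom.pi_apply, embed_x b.pos_injective]
    · intro c _ hc
      rw [map_mul, rep_X, rep_e, Module.End.mul_apply, opE_single_of_ne hc.symm, map_zero]
    · simp
  exact DFunLike.congr_fun h f

/-- The components of an element of `⨁_c P(c)` as rational functions. -/
def polValue (f : Pol d ℓ k) (c : J d ℓ) : LaurentField k (ℓ + d) :=
  embed (fun i : c.blacks => (i : Fin (ℓ + d))) (f c)

theorem embed_pos (c : J d ℓ) (f : Laurent k (Fin d)) :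
    embed c.pos f
      = embed (fun i : c.blacks => (i : Fin (ℓ + d))) (Laurent.rename k c.blackIso.toEquiv f) :=
  (embed_rename (j := fun i : c.blacks => (i : Fin (ℓ + d))) Subtype.val_injective
    c.blackIso.toEquiv f).symm

theorem Laurent.rename_symm_rename {σ τ : Type*} (w : σ ≃ τ) (f : Laurent k τ) :
    Laurent.rename k w (Laurent.rename k w.symm f) = f :=
  (Laurent.rename k w).apply_symm_apply f

theorem rep_polToHecke (f : Pol d ℓ k) : rep d q Q (polToHecke q Q f) = diagOp (polValue f) := by
  change rep d q Q (∑ c : J d ℓ,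
    laurentToHecke d q Q (Laurent.rename k c.blackIso.symm.toEquiv (f c)) * e q Q c) = _
  refine Finsupp.lhom_ext fun b g => ?_
  rw [map_sum, LinearMap.sum_apply, Finset.sum_eq_single b]
  · rw [map_mul, rep_laurentToHecke, rep_e, Module.End.mul_apply, opE_single_self, diagOp_single,
      diagOp_single, embed_pos]
    unfold polValue
    congr 3
    exact Laurent.rename_symm_rename b.blackIso.toEquiv (f b)
  · intro c _ hc
    rw [map_mul, rep_e, Module.End.mul_apply, opE_single_of_ne hc.symm, map_zero]
  · simp

theorem diagOp_injective :
    Function.Injective (diagOp : (J d ℓ → LaurentField k (ℓ + d)) → _) := by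
  intro χ ψ h
  funext c
  have h1 := LinearMap.congr_fun h (Finsupp.single c 1)
  rw [diagOp_single, diagOp_single, mul_one, mul_one] at h1
  exact Finsupp.single_injective c h1

theorem polValue_injective : Function.Injective (polValue : Pol d ℓ k → _) := by
  intro f g h
  funext c
  exact embed_injective (k := k) Subtype.val_injective (congrFun h c)

theorem polToHecke_injective : Function.Injective (polToHecke (d := d) q Q) := by
  intro f g h
  refine polValue_injective (diagOp_injective ?_)
  rw [← rep_polToHecke q Q, ← rep_polToHecke q Q, h]

theorem laurentToHecke_injective : Function.Injective (laurentToHecke d q Q) := by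
  intro f g h
  have h1 := congrArg (rep d q Q) h
  rw [rep_laurentToHecke, rep_laurentToHecke] at h1
  obtain ⟨c⟩ := (inferInstance : Nonempty (J d ℓ))
  exact embed_injective c.pos_injective (congrFun (diagOp_injective h1) c)

theorem polToHecke_single (c : J d ℓ) (f : Laurent k c.blacks) :
    polToHecke q Q (Pi.single c f)
      = laurentToHecke d q Q (Laurent.rename k c.blackIso.symm.toEquiv f) * e q Q c := by
  change (∑ b : J d ℓ, laurentToHecke d q Q
    (Laurent.rename k b.blackIso.symm.toEquiv ((Pi.single c f : Pol d ℓ k) b)) * e q Q b) = _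
  rw [Finset.sum_eq_single c]
  · rw [Pi.single_eq_same]
  · intro b _ hb
    rw [Pi.single_eq_of_ne hb, map_zero, map_zero, zero_mul]
  · simp

theorem e_mem_range (c : J d ℓ) : e q Q c ∈ (polToHecke (d := d) q Q).range :=
  ⟨Pi.single c 1, by
    change polToHecke q Q (Pi.single c 1) = _
    rw [polToHecke_single, map_one, map_one, one_mul]⟩

theorem sum_X_mul_e (t : Fin d) (c : J d ℓ) :
    (∑ b : J d ℓ, X q Q (b.pos t) * e q Q b) * e q Q c = X q Q (c.pos t) * e q Q c := by
  rw [Finset.sum_mul, Finset.sum_eq_single c]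
  · rw [mul_assoc, e_mul_self]
  · intro b _ hb
    rw [mul_assoc, e_mul_e_of_ne q Q b c hb, mul_zero]
  · simp

theorem sum_X'_mul_e (t : Fin d) (c : J d ℓ) :
    (∑ b : J d ℓ, X' q Q (b.pos t) * e q Q b) * e q Q c = X' q Q (c.pos t) * e q Q c := by
  rw [Finset.sum_mul, Finset.sum_eq_single c]
  · rw [mul_assoc, e_mul_self]
  · intro b _ hb
    rw [mul_assoc, e_mul_e_of_ne q Q b c hb, mul_zero]
  · simp

theorem X'_mul_e_red (i) (c : J d ℓ) (h : c.1 i = 1) : X' q Q i * e q Q c = 0 := by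
  have h := RingQuot.mkAlgHom_rel k (Rel.X'_red (q := q) (Q := Q) i c h)
  simp only [map_mul, map_zero] at h
  exact h

theorem J.exists_pos_eq (c : J d ℓ) {i : Fin (ℓ + d)} (h : c.1 i = 0) : ∃ t, c.pos t = i := by
  refine ⟨c.blackIso.symm ⟨i, by simp [J.blacks, h]⟩, ?_⟩
  unfold J.pos
  rw [OrderIso.apply_symm_apply]

theorem laurentToHecke_mul_e_mem_range (f : Laurent k (Fin d)) (c : J d ℓ) :
    laurentToHecke d q Q f * e q Q c ∈ (polToHecke (d := d) q Q).range :=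
  ⟨Pi.single c (Laurent.rename k c.blackIso.toEquiv f), by
    change polToHecke q Q (Pi.single c _) = _
    rw [polToHecke_single]
    congr 2
    exact (Laurent.rename k c.blackIso.toEquiv).symm_apply_apply f⟩

theorem laurentToHecke_x_inv (t : Fin d) :
    laurentToHecke d q Q (AddMonoidAlgebra.single (-Pi.single t 1) 1)
      = ((xUnit q Q t)⁻¹ : (Hecke d q Q)ˣ) := by
  refine left_inv_eq_right_inv (a := (xUnit q Q t : Hecke d q Q)) ?_ (Units.mul_inv _)
  rw [← laurentToHecke_x, ← map_mul]
  unfold Laurent.x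
  rw [AddMonoidAlgebra.single_mul_single, one_mul, neg_add_cancel]
  exact map_one _

theorem mem_range_of_mul_e {h : Hecke d q Q}
    (H : ∀ c, h * e q Q c ∈ (polToHecke (d := d) q Q).range) :
    h ∈ (polToHecke (d := d) q Q).range := by
  rw [← mul_one h, ← sum_e, Finset.mul_sum]
  exact Subalgebra.sum_mem _ fun c _ => H c

theorem X_mem_range (i : Fin (ℓ + d)) : X q Q i ∈ (polToHecke (d := d) q Q).range := by
  refine mem_range_of_mul_e q Q fun c => ?_
  by_cases h : c.1 i = 0
  · obtain ⟨t, rfl⟩ := c.exists_pos_eq h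
    rw [← sum_X_mul_e]
    change (xUnit q Q t : Hecke d q Q) * _ ∈ _
    rw [← laurentToHecke_x]
    exact laurentToHecke_mul_e_mem_range q Q _ c
  · rw [X_mul_e_red q Q i c ((c.colour_eq_one_iff i).2 h)]
    exact Subalgebra.zero_mem _

theorem X'_mem_range (i : Fin (ℓ + d)) : X' q Q i ∈ (polToHecke (d := d) q Q).range := by
  refine mem_range_of_mul_e q Q fun c => ?_
  by_cases h : c.1 i = 0
  · obtain ⟨t, rfl⟩ := c.exists_pos_eq h
    rw [← sum_X'_mul_e]
    change ((xUnit q Q t)⁻¹ : (Hecke d q Q)ˣ) * e q Q c ∈ _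
    rw [← laurentToHecke_x_inv]
    exact laurentToHecke_mul_e_mem_range q Q _ c
  · rw [X'_mul_e_red q Q i c ((c.colour_eq_one_iff i).2 h)]
    exact Subalgebra.zero_mem _

variable (d) in
/-- The subalgebra generated by all `e(c)`, `X_i` and `X'_i`. -/
def diagAlg : Subalgebra k (Hecke d q Q) :=
  Algebra.adjoin k (Set.range (e q Q) ∪ Set.range (X q Q) ∪ Set.range (X' q Q))

theorem diagAlg_le_range : diagAlg d q Q ≤ (polToHecke (d := d) q Q).range := by
  refine Algebra.adjoin_le ?_
  rintro _ ((⟨c, rfl⟩ | ⟨i, rfl⟩) | ⟨i, rfl⟩)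
  · exact e_mem_range q Q c
  · exact X_mem_range q Q i
  · exact X'_mem_range q Q i

theorem e_mem_diagAlg (c : J d ℓ) : e q Q c ∈ diagAlg d q Q :=
  Algebra.subset_adjoin (Or.inl (Or.inl ⟨c, rfl⟩))

theorem X_mem_diagAlg (i : Fin (ℓ + d)) : X q Q i ∈ diagAlg d q Q :=
  Algebra.subset_adjoin (Or.inl (Or.inr ⟨i, rfl⟩))

theorem X'_mem_diagAlg (i : Fin (ℓ + d)) : X' q Q i ∈ diagAlg d q Q :=
  Algebra.subset_adjoin (Or.inr ⟨i, rfl⟩)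

end Diagonal

/-! ### Normal words span the Hecke algebra -/

section Spanning

variable {d ℓ : ℕ} {k : Type*} [Field k] (q : k) (Q : Fin ℓ → k)

/-- The generators `T_r`, extended by zero. -/
def Tn (r : ℕ) : Hecke d q Q := if hr : r + 1 < ℓ + d then T q Q r hr else 0

variable (d ℓ) in
/-- The adjacent transpositions, extended by the identity. -/
def sn (r : ℕ) : Equiv.Perm (Fin (ℓ + d)) :=
  if hr : r + 1 < ℓ + d then Equiv.swap (lo r hr) (hi r hr) else 1

theorem Tn_of_lt {r : ℕ} (hr : r + 1 < ℓ + d) : Tn q Q r = T q Q r hr := dif_pos hr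

theorem sn_of_lt {r : ℕ} (hr : r + 1 < ℓ + d) : sn d ℓ r = Equiv.swap (lo r hr) (hi r hr) :=
  dif_pos hr

theorem Tn_of_le {r : ℕ} (hr : ℓ + d ≤ r + 1) : Tn (d := d) q Q r = 0 := dif_neg (by omega)

theorem T_mul_e (r : ℕ) (hr : r + 1 < ℓ + d) (c : J d ℓ) :
    T q Q r hr * e q Q c = e q Q (c.permute (Equiv.swap (lo r hr) (hi r hr))) * T q Q r hr := by
  have h := RingQuot.mkAlgHom_rel k (Rel.T_e (q := q) (Q := Q) r hr c)
  simp only [map_mul] at h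
  exact h

theorem Tn_mul_e (r : ℕ) (c : J d ℓ) :
    Tn q Q r * e q Q c = e q Q (c.permute (sn d ℓ r)) * Tn q Q r := by
  by_cases hr : r + 1 < ℓ + d
  · rw [Tn_of_lt q Q hr, sn_of_lt hr, T_mul_e]
  · rw [Tn_of_le q Q (not_lt.1 hr), zero_mul, mul_zero]

theorem T_mul_e_red (r : ℕ) (hr : r + 1 < ℓ + d) {c : J d ℓ} (h0 : c.1 (lo r hr) = 1)
    (h1 : c.1 (hi r hr) = 1) : T q Q r hr * e q Q c = 0 := by
  have h := RingQuot.mkAlgHom_rel k (Rel.T_red (q := q) (Q := Q) r hr c h0 h1)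
  simp only [map_mul, map_zero] at h
  exact h

theorem Tn_mul_Tn (r s : ℕ) (h : r + 1 < s) :
    Tn (d := d) q Q r * Tn q Q s = Tn q Q s * Tn q Q r := by
  by_cases hs : s + 1 < ℓ + d
  · have hr : r + 1 < ℓ + d := by omega
    rw [Tn_of_lt q Q hr, Tn_of_lt q Q hs]
    have h := RingQuot.mkAlgHom_rel k (Rel.T_comm (q := q) (Q := Q) r s hr hs (Or.inl h))
    simp only [map_mul] at h
    exact h
  · rw [Tn_of_le q Q (not_lt.1 hs), zero_mul, mul_zero]

theorem add_neg_one_smul (k : Type*) {M : Type*} [Field k] [AddCommMonoid M] [Module k M] (x : M) :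
    x + (-1 : k) • x = 0 := by
  calc x + (-1 : k) • x = (1 + (-1) : k) • x := by rw [add_smul, one_smul]
    _ = 0 := by rw [add_neg_cancel, zero_smul]

/-- An identity in the Hecke algebra up to diagonal terms can be checked on each `e(c)`. -/
theorem exists_diag_of_mul_e {y z : Hecke d q Q}
    (H : ∀ c, ∃ a ∈ diagAlg d q Q, ∃ b ∈ diagAlg d q Q, y * e q Q c = a * z + b) :
    ∃ a ∈ diagAlg d q Q, ∃ b ∈ diagAlg d q Q, y = a * z + b := by
  choose a ha b hb h using H
  refine ⟨∑ c, a c, Subalgebra.sum_mem _ fun c _ => ha c, ∑ c, b c,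
    Subalgebra.sum_mem _ fun c _ => hb c, ?_⟩
  rw [Finset.sum_mul, ← Finset.sum_add_distrib]
  calc y = y * ∑ c, e q Q c := by rw [sum_e, mul_one]
    _ = _ := by rw [Finset.mul_sum]; exact Finset.sum_congr rfl fun c _ => h c

/-- Moving `X_i` past `T_r`. -/
theorem T_mul_X_mul_e (r : ℕ) (hr : r + 1 < ℓ + d) (i : Fin (ℓ + d)) (c : J d ℓ) :
    ∃ p ∈ diagAlg d q Q, T q Q r hr * X q Q i * e q Q c
      = X q Q (Equiv.swap (lo r hr) (hi r hr) i) * T q Q r hr * e q Q c + p * e q Q c := by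
  by_cases h0 : i = lo r hr
  · subst h0
    rw [Equiv.swap_apply_left]
    by_cases h : c.1 (lo r hr) = 0 ∧ c.1 (hi r hr) = 0
    · have h := RingQuot.mkAlgHom_rel k (Rel.T_X_lo_black (q := q) (Q := Q) r hr c h.1 h.2)
      rw [← neg_smul] at h
      simp only [map_mul, map_sub, map_smul] at h
      refine ⟨(-(q - 1)) • X q Q (hi r hr), Subalgebra.smul_mem _ (X_mem_diagAlg q Q _) _, ?_⟩
      rw [smul_mul_assoc]
      exact (sub_eq_iff_eq_add'.1 ((sub_mul _ _ _).symm.trans h))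
    · have h := RingQuot.mkAlgHom_rel k (Rel.T_X_lo_red (q := q) (Q := Q) r hr c h)
      simp only [map_mul, map_sub, map_zero] at h
      refine ⟨0, Subalgebra.zero_mem _, ?_⟩
      rw [zero_mul]
      exact (sub_eq_iff_eq_add'.1 ((sub_mul _ _ _).symm.trans h))
  by_cases h1 : i = hi r hr
  · subst h1
    rw [Equiv.swap_apply_right]
    by_cases h : c.1 (lo r hr) = 0 ∧ c.1 (hi r hr) = 0
    · have h := RingQuot.mkAlgHom_rel k (Rel.T_X_hi_black (q := q) (Q := Q) r hr c h.1 h.2)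
      simp only [map_mul, map_sub, map_smul] at h
      refine ⟨(q - 1) • X q Q (hi r hr), Subalgebra.smul_mem _ (X_mem_diagAlg q Q _) _, ?_⟩
      rw [smul_mul_assoc]
      exact (sub_eq_iff_eq_add'.1 ((sub_mul _ _ _).symm.trans h))
    · have h := RingQuot.mkAlgHom_rel k (Rel.T_X_hi_red (q := q) (Q := Q) r hr c h)
      simp only [map_mul, map_sub, map_zero] at h
      refine ⟨0, Subalgebra.zero_mem _, ?_⟩
      rw [zero_mul]
      exact (sub_eq_iff_eq_add'.1 ((sub_mul _ _ _).symm.trans h))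
  · have h := RingQuot.mkAlgHom_rel k (Rel.T_X_comm (q := q) (Q := Q) r hr i h0 h1)
    simp only [map_mul] at h
    refine ⟨0, Subalgebra.zero_mem _, ?_⟩
    rw [Equiv.swap_apply_of_ne_of_ne h0 h1, zero_mul, add_zero]
    exact congrArg (· * e q Q c) h

theorem Tn_move (r : ℕ) {p : Hecke d q Q} (hp : p ∈ diagAlg d q Q) :
    ∃ a ∈ diagAlg d q Q, ∃ b ∈ diagAlg d q Q, Tn q Q r * p = a * Tn q Q r + b := by
  by_cases hr : r + 1 < ℓ + d
  swap
  · refine ⟨0, Subalgebra.zero_mem _, 0, Subalgebra.zero_mem _, ?_⟩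
    rw [Tn_of_le q Q (not_lt.1 hr), zero_mul, mul_zero, add_zero]
  rw [Tn_of_lt q Q hr]
  induction hp using Algebra.adjoin_induction with
  | mem p hp =>
    rcases hp with (⟨c, rfl⟩ | ⟨i, rfl⟩) | ⟨i, rfl⟩
    · exact ⟨_, e_mem_diagAlg q Q _, 0, Subalgebra.zero_mem _, by rw [add_zero, T_mul_e]⟩
    · refine exists_diag_of_mul_e q Q fun c => ?_
      obtain ⟨p, hp, h⟩ := T_mul_X_mul_e q Q r hr i c
      rw [mul_assoc (X q Q _), T_mul_e, ← mul_assoc (X q Q _)] at h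
      exact ⟨_, Subalgebra.mul_mem _ (X_mem_diagAlg q Q _) (e_mem_diagAlg q Q _), p * e q Q c,
        Subalgebra.mul_mem _ hp (e_mem_diagAlg q Q _), h⟩
    · refine exists_diag_of_mul_e q Q fun c => ?_
      by_cases hi' : c.1 i = 0
      · obtain ⟨p, hp, h⟩ := T_mul_X_mul_e q Q r hr i c
        set s := Equiv.swap (lo r hr) (hi r hr) with hs
        refine ⟨_, Subalgebra.mul_mem _ (X'_mem_diagAlg q Q (s i))
          (e_mem_diagAlg q Q (c.permute s)),
          (-1 : k) • (X' q Q (s i) * p * X' q Q i * e q Q c), Subalgebra.smul_mem _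
          (Subalgebra.mul_mem _ (Subalgebra.mul_mem _ (Subalgebra.mul_mem _
          (X'_mem_diagAlg q Q _) hp) (X'_mem_diagAlg q Q _)) (e_mem_diagAlg q Q _)) _, ?_⟩
        -- Multiply the relation for `X_i` by `X'_{s i}` from the left and by `X'_i` from the right.
        have h1 : T q Q r hr * e q Q c = X q Q (s i) * (T q Q r hr * (X' q Q i * e q Q c))
            + p * (X' q Q i * e q Q c) := by
          calc T q Q r hr * e q Q c
              = T q Q r hr * (X q Q i * X' q Q i * e q Q c) := by rw [X_X'_e q Q i c hi']
            _ = (T q Q r hr * X q Q i * e q Q c) * X' q Q i := by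
                simp only [mul_assoc, X'_comm_e]
            _ = _ := by rw [h]; simp only [mul_assoc, X'_comm_e, add_mul]
        have h2 : X' q Q (s i) * (X q Q (s i) * (T q Q r hr * (X' q Q i * e q Q c)))
            = T q Q r hr * (X' q Q i * e q Q c) := by
          rw [X'_comm_e, ← mul_assoc (T q Q r hr), T_mul_e, ← mul_assoc, ← mul_assoc, ← mul_assoc,
            X'_X_e q Q (s i) _ ((c.permute_apply_apply s i).trans hi')]
        rw [mul_assoc, ← h2, mul_assoc (X' q Q (s i)) (e q Q _), ← T_mul_e, h1]
        simp only [mul_add, mul_assoc]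
        rw [add_assoc, add_neg_one_smul k, add_zero]
      · refine ⟨0, Subalgebra.zero_mem _, 0, Subalgebra.zero_mem _, ?_⟩
        rw [mul_assoc, X'_mul_e_red q Q i c ((c.colour_eq_one_iff i).2 hi'), mul_zero, zero_mul,
          add_zero]
  | algebraMap x =>
    exact ⟨_, Subalgebra.algebraMap_mem _ x, 0, Subalgebra.zero_mem _, by
      rw [add_zero, Algebra.commutes]⟩
  | add x y _ _ hx hy =>
    obtain ⟨a, ha, b, hb, h⟩ := hx
    obtain ⟨a', ha', b', hb', h'⟩ := hy
    exact ⟨_, Subalgebra.add_mem _ ha ha', _, Subalgebra.add_mem _ hb hb', by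
      rw [mul_add, h, h', add_mul]; abel⟩
  | mul x y hx' hy' hx hy =>
    obtain ⟨a, ha, b, hb, h⟩ := hx
    obtain ⟨a', ha', b', hb', h'⟩ := hy
    exact ⟨_, Subalgebra.mul_mem _ ha ha', _, Subalgebra.add_mem _ (Subalgebra.mul_mem _ ha hb')
      (Subalgebra.mul_mem _ hb hy'), by
      rw [← mul_assoc, h, add_mul, mul_assoc a, h', mul_add, ← mul_assoc, add_assoc]⟩

theorem Tn_sq (r : ℕ) :
    ∃ a ∈ diagAlg d q Q, ∃ b ∈ diagAlg d q Q, Tn q Q r * Tn q Q r = a * Tn q Q r + b := by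
  by_cases hr : r + 1 < ℓ + d
  swap
  · refine ⟨0, Subalgebra.zero_mem _, 0, Subalgebra.zero_mem _, ?_⟩
    rw [Tn_of_le q Q (not_lt.1 hr), mul_zero, add_zero]
  rw [Tn_of_lt q Q hr]
  refine exists_diag_of_mul_e q Q fun c => ?_
  have hP : ∀ i (x : k), X q Q i * e q Q c - x • e q Q c ∈ diagAlg d q Q := fun i x =>
    Subalgebra.sub_mem _ (Subalgebra.mul_mem _ (X_mem_diagAlg q Q _) (e_mem_diagAlg q Q _))
      (Subalgebra.smul_mem _ (e_mem_diagAlg q Q _) _)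
  by_cases h0 : c.1 (lo r hr) = 0
  · by_cases h1 : c.1 (hi r hr) = 0
    · have h := RingQuot.mkAlgHom_rel k (Rel.T_sq_black (q := q) (Q := Q) r hr c h0 h1)
      simp only [map_mul, map_add, map_smul] at h
      refine ⟨_, Subalgebra.smul_mem _ (e_mem_diagAlg q Q
        (c.permute (Equiv.swap (lo r hr) (hi r hr)))) (q - 1), _,
        Subalgebra.smul_mem _ (e_mem_diagAlg q Q c) q, ?_⟩
      rw [smul_mul_assoc, ← T_mul_e]
      exact h
    · have h := RingQuot.mkAlgHom_rel k (Rel.T_sq_black_red (q := q) (Q := Q) r hr c h0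
        ((c.colour_eq_one_iff _).2 h1))
      simp only [map_mul, map_sub, map_smul] at h
      exact ⟨0, Subalgebra.zero_mem _, _, hP _ _, by rw [zero_mul, zero_add]; exact h⟩
  · have h0' := (c.colour_eq_one_iff _).2 h0
    by_cases h1 : c.1 (hi r hr) = 0
    · have h := RingQuot.mkAlgHom_rel k (Rel.T_sq_red_black (q := q) (Q := Q) r hr c h0' h1)
      simp only [map_mul, map_sub, map_smul] at h
      exact ⟨0, Subalgebra.zero_mem _, _, hP _ _, by rw [zero_mul, zero_add]; exact h⟩
    · refine ⟨0, Subalgebra.zero_mem _, 0, Subalgebra.zero_mem _, ?_⟩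
      rw [mul_assoc, T_mul_e_red q Q r hr h0' ((c.colour_eq_one_iff _).2 h1), mul_zero, zero_mul,
        zero_add]

/-- A red entry in the middle of three that is adjacent to another red entry kills both sides of
the braid relation. -/
theorem braid_red_red (r : ℕ) (hr : r + 1 < ℓ + d) (hr' : r + 1 + 1 < ℓ + d) (c : J d ℓ)
    (h : c.1 (hi r hr) = 1) (h' : ¬ (c.1 (lo r hr) = 0 ∧ c.1 (hi (r + 1) hr') = 0)) :
    T q Q (r + 1) hr' * T q Q r hr * T q Q (r + 1) hr' * e q Q c = 0 ∧
    T q Q r hr * T q Q (r + 1) hr' * T q Q r hr * e q Q c = 0 := by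
  have n1 : lo r hr ≠ lo (r + 1) hr' := by simp [Fin.ext_iff]
  have n2 : lo r hr ≠ hi (r + 1) hr' := by simp only [Ne, Fin.ext_iff]; omega
  have n3 : hi (r + 1) hr' ≠ lo r hr := n2.symm
  have n4 : hi (r + 1) hr' ≠ hi r hr := by simp [Fin.ext_iff]
  have e1 : lo (r + 1) hr' = hi r hr := rfl
  by_cases h0 : c.1 (lo r hr) = 1
  · constructor
    · by_cases h2 : c.1 (hi (r + 1) hr') = 1
      · rw [mul_assoc, T_mul_e_red q Q (r + 1) hr' h h2, mul_zero]
      · rw [mul_assoc, T_mul_e, mul_assoc, ← mul_assoc (T q Q r hr), T_mul_e, ← mul_assoc,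
          ← mul_assoc, T_mul_e_red, zero_mul, zero_mul]
        · rw [e1, J.permute_swap_right, ← e1, J.permute_swap_of_ne c n1 n2, h0]
        · rw [J.permute_swap_of_ne _ n3 n4, J.permute_swap_right, e1, h]
    · rw [mul_assoc, T_mul_e_red q Q r hr h0 h, mul_zero]
  · have h0' : c.1 (lo r hr) = 0 := by
      by_contra hc
      exact h0 ((c.colour_eq_one_iff _).2 hc)
    have h2 := (c.colour_eq_one_iff _).2 fun h2 => h' ⟨h0', h2⟩
    constructor
    · rw [mul_assoc, T_mul_e_red q Q (r + 1) hr' h h2, mul_zero]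
    · rw [mul_assoc, T_mul_e, mul_assoc, ← mul_assoc (T q Q (r + 1) hr'), T_mul_e, ← mul_assoc,
        ← mul_assoc, T_mul_e_red, zero_mul, zero_mul]
      · rw [J.permute_swap_of_ne _ n1 n2, J.permute_swap_left, h]
      · rw [← e1, J.permute_swap_left, J.permute_swap_of_ne _ n3 n4, h2]

theorem Tn_braid (r : ℕ) :
    ∃ b ∈ diagAlg d q Q, Tn q Q (r + 1) * Tn q Q r * Tn q Q (r + 1)
      = Tn q Q r * Tn q Q (r + 1) * Tn q Q r + b := by
  by_cases hr' : r + 1 + 1 < ℓ + d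
  swap
  · refine ⟨0, Subalgebra.zero_mem _, ?_⟩
    rw [Tn_of_le q Q (not_lt.1 hr'), mul_zero, mul_zero, zero_mul, add_zero]
  have hr : r + 1 < ℓ + d := by omega
  rw [Tn_of_lt q Q hr, Tn_of_lt q Q hr']
  have key : ∀ c, ∃ b ∈ diagAlg d q Q,
      T q Q (r + 1) hr' * T q Q r hr * T q Q (r + 1) hr' * e q Q c
        = T q Q r hr * T q Q (r + 1) hr' * T q Q r hr * e q Q c + b := by
    intro c
    by_cases h : c.1 (hi r hr) = 0
    · have h1 := RingQuot.mkAlgHom_rel k (Rel.braid (q := q) (Q := Q) r hr hr' c h)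
      simp only [map_mul, map_sub, map_zero] at h1
      refine ⟨0, Subalgebra.zero_mem _, ?_⟩
      rw [add_zero]
      exact (sub_eq_zero.1 ((sub_mul _ _ _).symm.trans h1)).symm
    · have h := (c.colour_eq_one_iff _).2 h
      by_cases h' : c.1 (lo r hr) = 0 ∧ c.1 (hi (r + 1) hr') = 0
      · have h1 := RingQuot.mkAlgHom_rel k
          (Rel.braid_red (q := q) (Q := Q) r hr hr' c h'.1 h h'.2)
        simp only [map_mul, map_sub, map_smul] at h1
        refine ⟨(-1 : k) • (1 - q) • (X q Q (hi (r + 1) hr') * e q Q c), Subalgebra.smul_mem _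
          (Subalgebra.smul_mem _ (Subalgebra.mul_mem _ (X_mem_diagAlg q Q _)
          (e_mem_diagAlg q Q _)) _) _, ?_⟩
        have h2 : T q Q r hr * T q Q (r + 1) hr' * T q Q r hr * e q Q c
            = T q Q (r + 1) hr' * T q Q r hr * T q Q (r + 1) hr' * e q Q c
              + (1 - q) • (X q Q (hi (r + 1) hr') * e q Q c) :=
          sub_eq_iff_eq_add'.1 ((sub_mul _ _ _).symm.trans h1)
        rw [h2, add_assoc, add_neg_one_smul k, add_zero]
      · obtain ⟨h1, h2⟩ := braid_red_red q Q r hr hr' c h h'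
        exact ⟨0, Subalgebra.zero_mem _, by rw [h1, h2, add_zero]⟩
  choose b hb h using key
  refine ⟨∑ c, b c, Subalgebra.sum_mem _ fun c _ => hb c, ?_⟩
  have h1 := Finset.sum_congr rfl fun c (_ : c ∈ Finset.univ) => h c
  rw [Finset.sum_add_distrib, ← Finset.mul_sum, ← Finset.mul_sum, sum_e, mul_one, mul_one] at h1
  exact h1

theorem isHeckeLike : IsHeckeLike (diagAlg d q Q) (Tn q Q) where
  comm := Tn_mul_Tn q Q
  move r _ hp := Tn_move q Q r hp
  sq := Tn_sq q Q
  braid := Tn_braid q Q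

theorem adjoin_diagAlg_Tn :
    Algebra.adjoin k ((diagAlg d q Q : Set (Hecke d q Q)) ∪ Set.range (Tn q Q)) = ⊤ := by
  rw [eq_top_iff]
  rintro h -
  obtain ⟨f, rfl⟩ := RingQuot.mkAlgHom_surjective k (Rel (d := d) q Q) h
  have h1 : ∀ x ∈ diagAlg d q Q, x ∈ Algebra.adjoin k
      ((diagAlg d q Q : Set (Hecke d q Q)) ∪ Set.range (Tn q Q)) :=
    fun x hx => Algebra.subset_adjoin (Or.inl hx)
  induction f using FreeAlgebra.induction with
  | grade0 a =>
    rw [AlgHom.commutes]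
    exact Subalgebra.algebraMap_mem _ a
  | grade1 g =>
    cases g with
    | e c => exact h1 _ (e_mem_diagAlg q Q c)
    | X i => exact h1 _ (X_mem_diagAlg q Q i)
    | X' i => exact h1 _ (X'_mem_diagAlg q Q i)
    | T r hr => exact Algebra.subset_adjoin (Or.inr ⟨r, Tn_of_lt q Q hr⟩)
  | mul a b ha hb => rw [map_mul]; exact Subalgebra.mul_mem _ ha hb
  | add a b ha hb => rw [map_add]; exact Subalgebra.add_mem _ ha hb

theorem normalSpan_diagAlg :
    normalSpan (diagAlg d q Q) (Tn q Q) (ℓ + d) = ⊤ :=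
  (isHeckeLike q Q).normalSpan_eq_top (ℓ + d) (fun _ hr => Tn_of_le q Q hr)
    (adjoin_diagAlg_Tn q Q)

end Spanning

/-! ### Permutations of normal words -/

section WordPerm

variable {d ℓ : ℕ} {k : Type*} [Field k] (q : k) (Q : Fin ℓ → k)

theorem wordProd_Tn_mul_e (u : List ℕ) (c : J d ℓ) :
    wordProd (Tn q Q) u * e q Q c
      = e q Q (c.permute (wordProd (sn d ℓ) u)) * wordProd (Tn q Q) u := by
  induction u with
  | nil => rw [wordProd_nil, wordProd_nil, one_mul, mul_one, J.permute_one]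
  | cons r u ih =>
    rw [wordProd_cons, wordProd_cons, mul_assoc, ih, ← mul_assoc, Tn_mul_e, mul_assoc,
      J.permute_permute]

/-- The permutation `w` does not change the order of the red entries of `c`. -/
def MonoRed (w : Equiv.Perm (Fin (ℓ + d))) (c : J d ℓ) : Prop :=
  ∀ i j, c.1 i = 1 → c.1 j = 1 → i < j → w i < w j

theorem monoRed_one (c : J d ℓ) : MonoRed 1 c := fun _ _ _ _ h => h

theorem MonoRed.swap_mul {w : Equiv.Perm (Fin (ℓ + d))} {c : J d ℓ} (hw : MonoRed w c) {r : ℕ}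
    (hr : r + 1 < ℓ + d)
    (h : ¬ ((c.permute w).1 (lo r hr) = 1 ∧ (c.permute w).1 (hi r hr) = 1)) :
    MonoRed (Equiv.swap (lo r hr) (hi r hr) * w) c := by
  intro i j hi' hj' hij
  have h1 := hw i j hi' hj' hij
  rw [Equiv.Perm.mul_apply, Equiv.Perm.mul_apply]
  have h2 : ¬ (w i = lo r hr ∧ w j = hi r hr) := by
    rintro ⟨h3, h4⟩
    apply h
    rw [← h3, ← h4, J.permute_apply_apply, J.permute_apply_apply]
    exact ⟨hi', hj'⟩
  rw [Equiv.swap_apply_def, Equiv.swap_apply_def]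
  simp only [Fin.ext_iff, Fin.lt_def] at *
  split_ifs <;> (try simp only []) <;> omega

/-- A product of generators `T_r` vanishes on `e(c)` if it makes red entries cross. -/
theorem wordProd_Tn_mul_e_eq_zero_or (u : List ℕ) (c : J d ℓ) :
    wordProd (Tn q Q) u * e q Q c = 0 ∨ MonoRed (wordProd (sn d ℓ) u) c := by
  induction u with
  | nil => exact Or.inr (monoRed_one c)
  | cons r u ih =>
    rw [wordProd_cons, wordProd_cons, mul_assoc]
    rcases ih with ih | ih
    · exact Or.inl (by rw [ih, mul_zero])
    · by_cases hr : r + 1 < ℓ + d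
      · rw [Tn_of_lt q Q hr, sn_of_lt hr]
        by_cases h : (c.permute (wordProd (sn d ℓ) u)).1 (lo r hr) = 1 ∧
          (c.permute (wordProd (sn d ℓ) u)).1 (hi r hr) = 1
        · refine Or.inl ?_
          rw [wordProd_Tn_mul_e, ← mul_assoc, T_mul_e_red q Q r hr h.1 h.2, zero_mul]
        · exact Or.inr (ih.swap_mul hr h)
      · exact Or.inl (by rw [Tn_of_le q Q (not_lt.1 hr), zero_mul])

theorem sn_apply_of_lt {r : ℕ} {i : Fin (ℓ + d)} (h : r + 1 < i) : sn d ℓ r i = i := by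
  unfold sn
  split_ifs with hr
  · refine Equiv.swap_apply_of_ne_of_ne ?_ ?_ <;> simp only [Ne, Fin.ext_iff] <;> omega
  · rfl

theorem wordProd_sn_apply {m : ℕ} {u : List ℕ} (hu : ∀ r ∈ u, r + 1 < m) {i : Fin (ℓ + d)}
    (hi : m ≤ i) : wordProd (sn d ℓ) u i = i := by
  induction u with
  | nil => rfl
  | cons r u ih =>
    rw [wordProd_cons, Equiv.Perm.mul_apply, ih fun s hs => hu s (by simp [hs])]
    exact sn_apply_of_lt (by have := hu r (by simp); omega)

theorem wordProd_sn_descend {j n : ℕ} (h : j + n < ℓ + d) :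
    wordProd (sn d ℓ) (descend j n) ⟨j, by omega⟩ = ⟨j + n, h⟩ := by
  induction n generalizing j with
  | zero => rfl
  | succ n ih =>
    rw [wordProd_descend_succ, Equiv.Perm.mul_apply, sn_of_lt (by omega : j + 1 < ℓ + d),
      Equiv.swap_apply_left, ih (by omega)]
    exact Fin.ext (by change j + 1 + n = j + (n + 1); omega)

/-- Different normal words give different permutations. -/
theorem wordProd_sn_injOn {m : ℕ} (hm : m ≤ ℓ + d) :
    Set.InjOn (wordProd (sn d ℓ)) (normalWords m) := by
  induction m with
  | zero =>
    intro u hu v hv _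
    rw [show u = [] from hu, show v = [] from hv]
  | succ m ih =>
    rintro _ ⟨u, hu, j, n, hjn, rfl⟩ _ ⟨u', hu', j', n', hjn', rfl⟩ h
    have hm' : m < ℓ + d := by omega
    have key : ∀ {u j n}, u ∈ normalWords m → ∀ hjn : j + n = m,
        wordProd (sn d ℓ) (u ++ descend j n) ⟨j, by omega⟩ = ⟨m, hm'⟩ := by
      intro u j n hu hjn
      rw [wordProd_append, Equiv.Perm.mul_apply, wordProd_sn_descend (by omega),
        wordProd_sn_apply (fun r hr => lt_of_mem_normalWords hu hr) (by simp [hjn])]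
      exact Fin.ext hjn
    have h1 := key hu hjn
    rw [h, ← key hu' hjn'] at h1
    have hj : j = j' := by simpa using (wordProd (sn d ℓ) _).injective h1
    subst hj
    obtain rfl : n = n' := by omega
    rw [wordProd_append, wordProd_append] at h
    rw [ih (by omega) hu hu' (mul_right_cancel h)]

end WordPerm

/-! ### Faithfulness of the polynomial representation -/

section Faithful

variable {d ℓ : ℕ} {k : Type*} [Field k] (q : k) (Q : Fin ℓ → k)

theorem mem_closure_adjacent_swap {N : ℕ} (w : Equiv.Perm (Fin N)) :
    w ∈ Submonoid.closure {s | ∃ (r : ℕ) (hr : r + 1 < N),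
      s = Equiv.swap ⟨r, Nat.lt_of_succ_lt hr⟩ ⟨r + 1, hr⟩} := by
  cases N with
  | zero => rw [Subsingleton.elim w 1]; exact Submonoid.one_mem _
  | succ m =>
    have h : w ∈ Submonoid.closure (Set.range fun i : Fin m => Equiv.swap i.castSucc i.succ) := by
      rw [Equiv.Perm.mclosure_swap_castSucc_succ]
      trivial
    refine Submonoid.closure_mono ?_ h
    rintro _ ⟨i, rfl⟩
    exact ⟨i, by omega, rfl⟩

/-- Induction on permutations by multiplication with adjacent transpositions from the left. -/
theorem perm_induction {p : Equiv.Perm (Fin (ℓ + d)) → Prop} (one : p 1)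
    (mul : ∀ r (hr : r + 1 < ℓ + d) w, p w → p (Equiv.swap (lo r hr) (hi r hr) * w))
    (w : Equiv.Perm (Fin (ℓ + d))) : p w := by
  have hw := mem_closure_adjacent_swap w
  induction hw using Submonoid.closure_induction_left with
  | one => exact one
  | mul_left s hs w _ ih =>
    obtain ⟨r, hr, rfl⟩ := hs
    exact mul r hr w ih

theorem coeffB_ne_zero {a b : Fin (ℓ + d)} (hab : a ≠ b) {c : J d ℓ}
    (h : ¬ (c.1 a = 1 ∧ c.1 b = 1)) : coeffB q Q a b c ≠ 0 := by
  unfold coeffB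
  rw [c.colour_eq_one_iff, c.colour_eq_one_iff] at h
  split_ifs with ha hb hb
  · exact div_ne_zero (sub_ne_zero.2 (algebraMap_mul_fracX_ne q hab).symm)
      (fracX_sub_ne_zero hab.symm)
  · exact one_ne_zero
  · exact sub_ne_zero.2 (fracX_ne_algebraMap _ _)
  · exact absurd ⟨ha, hb⟩ h

/-- An element of the Hecke algebra that acts on the component of `c` as an adjacent transposition,
up to a nonzero factor. -/
theorem exists_swap_intertwiner (r : ℕ) (hr : r + 1 < ℓ + d) {c : J d ℓ}
    (h : ¬ (c.1 (lo r hr) = 1 ∧ c.1 (hi r hr) = 1)) :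
    ∃ (x : Hecke d q Q) (β : LaurentField k (ℓ + d)), β ≠ 0 ∧ ∀ f,
      rep d q Q x (Finsupp.single c f) = Finsupp.single
        (c.permute (Equiv.swap (lo r hr) (hi r hr)))
        (β * act k (Equiv.swap (lo r hr) (hi r hr)) f) := by
  have hB := coeffB_ne_zero q Q (lo_ne_hi r hr) h
  have hX := fracX_sub_ne_zero (k := k) (lo_ne_hi r hr).symm
  by_cases hb : c.1 (lo r hr) = 0 ∧ c.1 (hi r hr) = 0
  · -- On two black entries the scalar part of `T_r` is removed after clearing its denominator.
    refine ⟨X q Q (hi r hr) * T q Q r hr + (-1 : k) • (X q Q (lo r hr) * T q Q r hr)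
      + (-(q - 1)) • X q Q (hi r hr), _, mul_ne_zero hX hB, fun f => ?_⟩
    rw [map_add, map_add, map_smul, map_smul, map_mul, map_mul, rep_T, rep_X, rep_X,
      LinearMap.add_apply, LinearMap.add_apply, LinearMap.smul_apply, LinearMap.smul_apply,
      Module.End.mul_apply, Module.End.mul_apply, opT_single,
      J.permute_swap_of_eq (hb.1.trans hb.2.symm), ← Finsupp.single_add, opX_single, opX_single,
      opX_single, if_pos hb.1, if_pos hb.2, Finsupp.smul_single, Finsupp.smul_single,
      ← Finsupp.single_add, ← Finsupp.single_add]
    congr 1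
    rw [Algebra.smul_def, Algebra.smul_def, coeffA, if_pos hb]
    simp only [map_neg, map_sub, map_one]
    field_simp
    ring
  · refine ⟨T q Q r hr, _, hB, fun f => ?_⟩
    rw [rep_T, opT_single]
    simp [coeffA, hb]

/-- Up to what it does to the red positions, each permutation is realised on the component of `c`
by an element of the Hecke algebra, up to a nonzero factor. -/
theorem exists_intertwiner (w : Equiv.Perm (Fin (ℓ + d))) (c : J d ℓ) :
    ∃ (x : Hecke d q Q) (v : Equiv.Perm (Fin (ℓ + d))) (β : LaurentField k (ℓ + d)),
      β ≠ 0 ∧ MonoRed v c ∧ (∀ i, c.1 i = 0 → v i = w i) ∧ ∀ f,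
      rep d q Q x (Finsupp.single c f) = Finsupp.single (c.permute v) (β * act k v f) := by
  induction w using perm_induction with
  | one =>
    exact ⟨1, 1, 1, one_ne_zero, monoRed_one c, fun _ _ => rfl, fun f => by simp⟩
  | mul r hr w ih =>
    obtain ⟨x, v, β, hβ, hv, hvw, hx⟩ := ih
    by_cases h : (c.permute v).1 (lo r hr) = 1 ∧ (c.permute v).1 (hi r hr) = 1
    · refine ⟨x, v, β, hβ, hv, fun i hi' => ?_, hx⟩
      have h1 := (c.permute_apply_apply v i).trans hi'
      rw [Equiv.Perm.mul_apply, ← hvw i hi', Equiv.swap_apply_of_ne_of_ne]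
      · intro h2
        rw [h2, h.1] at h1
        exact one_ne_zero h1
      · intro h2
        rw [h2, h.2] at h1
        exact one_ne_zero h1
    · obtain ⟨y, γ, hγ, hy⟩ := exists_swap_intertwiner q Q r hr h
      refine ⟨y * x, Equiv.swap (lo r hr) (hi r hr) * v,
        γ * act k (Equiv.swap (lo r hr) (hi r hr)) β, mul_ne_zero hγ ?_, hv.swap_mul hr h,
        fun i hi' => ?_, fun f => ?_⟩
      · exact (map_ne_zero_iff _ (act k _).injective).2 hβ
      · rw [Equiv.Perm.mul_apply, hvw i hi', Equiv.Perm.mul_apply]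
      · rw [map_mul, Module.End.mul_apply, hx, hy, J.permute_permute, map_mul, act_act, mul_assoc]

/-- A permutation that preserves the order of the red entries is determined by its values on the
black positions. -/
theorem MonoRed.eq_of_eq_on_black {v w : Equiv.Perm (Fin (ℓ + d))} {c : J d ℓ}
    (hv : MonoRed v c) (hw : MonoRed w c) (h : ∀ i, c.1 i = 0 → v i = w i) : v = w := by
  have hv' : StrictMono fun i : {i // c.1 i = 1} => v i := fun i j hij => hv i j i.2 j.2 hij
  have hw' : StrictMono fun i : {i // c.1 i = 1} => w i := fun i j hij => hw i j i.2 j.2 hij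
  have hsub : ∀ {v w : Equiv.Perm (Fin (ℓ + d))}, (∀ i, c.1 i = 0 → v i = w i) →
      (Set.range fun i : {i // c.1 i = 1} => v i) ⊆ Set.range fun i : {i // c.1 i = 1} => w i := by
    rintro v w h _ ⟨⟨i, hi'⟩, rfl⟩
    refine ⟨⟨w⁻¹ (v i), ?_⟩, by simp⟩
    rw [c.colour_eq_one_iff]
    intro h0
    have h1 := h _ h0
    rw [show w (w⁻¹ (v i)) = v i by simp] at h1
    rw [v.injective h1, hi'] at h0
    exact one_ne_zero h0
  have hrange := (hv'.range_inj hw').1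
    (Set.Subset.antisymm (hsub h) (hsub fun i hi' => (h i hi').symm))
  ext i
  by_cases hi' : c.1 i = 0
  · rw [h i hi']
  · rw [congrFun hrange ⟨i, (c.colour_eq_one_iff i).2 hi'⟩]

/-- The permutations from `c` to `b` that preserve the order of the red entries. -/
abbrev RedPerm (b c : J d ℓ) : Type _ :=
  {w : Equiv.Perm (Fin (ℓ + d)) // c.permute w = b ∧ MonoRed w c}

/-- The matrix entry of an operator from the component of `c` to that of `b`. -/
def block (A : Module.End k (RepSpace d ℓ k)) (b c : J d ℓ) :
    LaurentField k (ℓ + d) → LaurentField k (ℓ + d) := fun f => A (Finsupp.single c f) b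

theorem ext_block {A B : Module.End k (RepSpace d ℓ k)} (h : ∀ b c, block A b c = block B b c) :
    A = B :=
  Finsupp.lhom_ext fun c f => Finsupp.ext fun b => congrFun (h b c) f

theorem normalWords_finite : (normalWords (ℓ + d)).Finite :=
  Set.Finite.of_injOn (Set.mapsTo_univ _ _) (wordProd_sn_injOn le_rfl) Set.finite_univ

variable (d ℓ) in
/-- The normal words, as a finite set. -/
def normalFinset : Finset (List ℕ) := (normalWords_finite (d := d) (ℓ := ℓ)).toFinset

theorem mem_normalFinset {u : List ℕ} : u ∈ normalFinset d ℓ ↔ u ∈ normalWords (ℓ + d) :=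
  Set.Finite.mem_toFinset _

open scoped Classical in
/-- The normal words whose permutation leads from `c` to `b` and preserves the order of the red
entries. -/
def blockWords (b c : J d ℓ) : Finset (List ℕ) :=
  (normalFinset d ℓ).filter fun u =>
    c.permute (wordProd (sn d ℓ) u) = b ∧ MonoRed (wordProd (sn d ℓ) u) c

open scoped Classical in
theorem mem_blockWords {b c : J d ℓ} {u : List ℕ} : u ∈ blockWords b c ↔
    u ∈ normalFinset d ℓ ∧
      c.permute (wordProd (sn d ℓ) u) = b ∧ MonoRed (wordProd (sn d ℓ) u) c := by
  unfold blockWords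
  exact Finset.mem_filter

theorem exists_normal_form (h : Hecke d q Q) : ∃ f : List ℕ → Pol d ℓ k,
    h = ∑ u ∈ normalFinset d ℓ, polToHecke q Q (f u) * wordProd (Tn q Q) u := by
  have hh : h ∈ normalSpan (diagAlg d q Q) (Tn q Q) (ℓ + d) := by
    rw [normalSpan_diagAlg]; exact Submodule.mem_top
  obtain ⟨l, hl, rfl⟩ := (Finsupp.mem_span_image_iff_linearCombination _).1 hh
  have h1 : ∀ u, ∃ f : Pol d ℓ k, polToHecke q Q f = l u := fun u =>
    diagAlg_le_range q Q (l u).2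
  choose f hf using h1
  refine ⟨f, ?_⟩
  rw [Finsupp.linearCombination_apply, Finsupp.sum_of_support_subset (s := normalFinset d ℓ)]
  · exact Finset.sum_congr rfl fun u _ => by rw [hf, Subalgebra.smul_def, smul_eq_mul]
  · intro u hu
    exact mem_normalFinset.2 (hl hu)
  · intro u _
    exact zero_smul _ _

theorem block_word_eq_zero {u : List ℕ} (hu : u ∈ normalFinset d ℓ) {b c : J d ℓ}
    (h : u ∉ blockWords b c) : e q Q b * wordProd (Tn q Q) u * e q Q c = 0 := by
  rw [mul_assoc]
  rcases wordProd_Tn_mul_e_eq_zero_or q Q u c with h1 | h1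
  · rw [h1, mul_zero]
  · rw [wordProd_Tn_mul_e, ← mul_assoc, e_mul_e_of_ne, zero_mul]
    intro h2
    exact h (mem_blockWords.2 ⟨hu, h2.symm, h1⟩)

theorem block_e_mul_mul_e (h : Hecke d q Q) (b c : J d ℓ) :
    block (rep d q Q (e q Q b * h * e q Q c)) b c = block (rep d q Q h) b c := by
  funext f
  unfold block
  rw [map_mul, map_mul, rep_e, rep_e, Module.End.mul_apply, opE_single_self, Module.End.mul_apply,
    opE, diagOp_apply, Pi.single_eq_same, one_mul]

theorem block_polToHecke_mul (f : Pol d ℓ k) (h : Hecke d q Q) (b c : J d ℓ) :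
    block (rep d q Q (polToHecke q Q f * h)) b c = polValue f b • block (rep d q Q h) b c := by
  funext g
  unfold block
  rw [map_mul, rep_polToHecke, Module.End.mul_apply, diagOp_apply]
  rfl

theorem block_sum {ι : Type*} (s : Finset ι) (h : ι → Hecke d q Q) (b c : J d ℓ) :
    block (rep d q Q (∑ i ∈ s, h i)) b c = ∑ i ∈ s, block (rep d q Q (h i)) b c := by
  funext g
  unfold block
  rw [map_sum, LinearMap.sum_apply, Finsupp.finsetSum_apply, Finset.sum_apply]

theorem block_normal_form (f : List ℕ → Pol d ℓ k) (b c : J d ℓ) :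
    block (rep d q Q (∑ u ∈ normalFinset d ℓ, polToHecke q Q (f u) * wordProd (Tn q Q) u)) b c
      = ∑ u ∈ blockWords b c, polValue (f u) b • block (rep d q Q (wordProd (Tn q Q) u)) b c := by
  rw [block_sum]
  symm
  refine (Finset.sum_subset (fun u hu => (mem_blockWords.1 hu).1) fun u hu h => ?_).trans
    (Finset.sum_congr rfl fun u _ => (block_polToHecke_mul q Q _ _ b c).symm)
  rw [← block_e_mul_mul_e, block_word_eq_zero q Q hu h, map_zero]
  exact smul_zero _

theorem card_blockWords_le (b c : J d ℓ) :
    Fintype.card (blockWords b c) ≤ Nat.card (RedPerm b c) := by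
  rw [← Nat.card_eq_fintype_card]
  refine Nat.card_le_card_of_injective
    (fun u => (⟨wordProd (sn d ℓ) u.1, (mem_blockWords.1 u.2).2⟩ : RedPerm b c)) ?_
  intro u v huv
  refine Subtype.ext (wordProd_sn_injOn le_rfl ?_ ?_ (congrArg Subtype.val huv))
  · exact mem_normalFinset.1 (mem_blockWords.1 u.2).1
  · exact mem_normalFinset.1 (mem_blockWords.1 v.2).1

/-- A family that spans a space containing at least as many independent vectors is independent and
spans nothing else. -/
theorem linearIndependent_of_card_le {K V ι κ : Type*} [Field K] [AddCommGroup V] [Module K V]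
    [Fintype ι] [Finite κ] {v : ι → V} {g : κ → V} (hg : LinearIndependent K g)
    (hcard : Fintype.card ι ≤ Nat.card κ) (hsub : ∀ j, g j ∈ Submodule.span K (Set.range v)) :
    LinearIndependent K v ∧ Submodule.span K (Set.range v) = Submodule.span K (Set.range g) := by
  have := Fintype.ofFinite κ
  rw [Nat.card_eq_fintype_card] at hcard
  have hle : Submodule.span K (Set.range g) ≤ Submodule.span K (Set.range v) :=
    Submodule.span_le.2 (by rintro _ ⟨j, rfl⟩; exact hsub j)
  have hfin : FiniteDimensional K (Submodule.span K (Set.range v)) :=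
    FiniteDimensional.span_of_finite K (Set.finite_range v)
  have h1 := finrank_span_eq_card hg
  have h2 := Submodule.finrank_mono hle
  refine ⟨linearIndependent_iff_card_le_finrank_span.2 ?_, ?_⟩
  · exact hcard.trans (h1.ge.trans h2)
  · refine (Submodule.eq_of_le_of_finrank_le hle ?_).symm
    rw [h1]
    exact (finrank_range_le_card v).trans hcard

theorem linearIndependent_redPerm (b c : J d ℓ) :
    LinearIndependent (LaurentField k (ℓ + d)) (fun w : RedPerm b c =>
      (fun f => act k w.1 f : LaurentField k (ℓ + d) → LaurentField k (ℓ + d))) :=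
  (linearIndependent_act (k := k)).comp (fun w : RedPerm b c => w.1) Subtype.val_injective

/-- Dedekind's theorem and a count of dimensions: the blocks of the normal words are linearly
independent, and they span the same space as the permutations. -/
theorem blocks_linearIndependent_and_span (b c : J d ℓ) :
    LinearIndependent (LaurentField k (ℓ + d)) (fun u : blockWords b c =>
      block (rep d q Q (wordProd (Tn q Q) u)) b c) ∧
    Submodule.span (LaurentField k (ℓ + d)) (Set.range fun u : blockWords b c =>
      block (rep d q Q (wordProd (Tn q Q) u)) b c) =
    Submodule.span (LaurentField k (ℓ + d)) (Set.range fun w : RedPerm b c =>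
      (fun f => act k w.1 f : LaurentField k (ℓ + d) → LaurentField k (ℓ + d))) := by
  refine linearIndependent_of_card_le (linearIndependent_redPerm b c) (card_blockWords_le b c) ?_
  rintro ⟨w, rfl, hw⟩
  obtain ⟨x, v, β, hβ, hv, hvw, hx⟩ := exists_intertwiner q Q w c
  obtain rfl : v = w := hv.eq_of_eq_on_black hw hvw
  have h1 : block (rep d q Q x) (c.permute v) c = β • fun f => act k v f := by
    funext f
    unfold block
    rw [hx, Finsupp.single_eq_same]
    rfl
  have h2 : (fun f => act k v f : LaurentField k (ℓ + d) → LaurentField k (ℓ + d))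
      = β⁻¹ • block (rep d q Q x) (c.permute v) c := by
    rw [h1, smul_smul, inv_mul_cancel₀ hβ, one_smul]
  change (fun f => act k v f : LaurentField k (ℓ + d) → LaurentField k (ℓ + d)) ∈ _
  rw [h2]
  refine Submodule.smul_mem _ _ ?_
  obtain ⟨f, rfl⟩ := exists_normal_form q Q x
  rw [block_normal_form]
  exact Submodule.sum_mem _ fun u hu => Submodule.smul_mem _ _
    (Submodule.subset_span ⟨⟨u, hu⟩, rfl⟩)

theorem coeff_eq_zero_of_sum_block {b c : J d ℓ} {g : List ℕ → LaurentField k (ℓ + d)}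
    (h : ∑ u ∈ blockWords b c, g u • block (rep d q Q (wordProd (Tn q Q) u)) b c = 0) :
    ∀ u ∈ blockWords b c, g u = 0 := by
  intro u hu
  have h1 := (blocks_linearIndependent_and_span q Q b c).1
  rw [Fintype.linearIndependent_iff] at h1
  refine h1 (fun u => g u.1) ?_ ⟨u, hu⟩
  rw [← h]
  exact Finset.sum_coe_sort (blockWords b c)
    (fun u => g u • block (rep d q Q (wordProd (Tn q Q) u)) b c)

theorem e_mul_polToHecke (f : Pol d ℓ k) (b : J d ℓ) :
    e q Q b * polToHecke q Q f = polToHecke q Q f * e q Q b := by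
  obtain ⟨x, hx⟩ := e_mem_range q Q b
  have hx : polToHecke q Q x = e q Q b := hx
  rw [← hx, ← map_mul, ← map_mul, mul_comm]

theorem e_mul_polToHecke_eq_zero {f : Pol d ℓ k} {b : J d ℓ} (h : polValue f b = 0) :
    e q Q b * polToHecke q Q f = 0 := by
  have hf : f b = 0 := by
    refine embed_injective (k := k) (j := fun i : b.blacks => (i : Fin (ℓ + d)))
      Subtype.val_injective ?_
    rw [map_zero]
    exact h
  rw [e_mul_polToHecke]
  change (∑ c : J d ℓ,
    laurentToHecke d q Q (Laurent.rename k c.blackIso.symm.toEquiv (f c)) * e q Q c) * _ = 0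
  rw [Finset.sum_mul]
  refine Finset.sum_eq_zero fun c _ => ?_
  by_cases hc : c = b
  · subst hc
    rw [hf, map_zero, map_zero, zero_mul, zero_mul]
  · rw [mul_assoc, e_mul_e_of_ne q Q c b hc, mul_zero]

/-- The polynomial representation is faithful. -/
theorem rep_injective : Function.Injective (rep d q Q) := by
  rw [injective_iff_map_eq_zero]
  intro h hh
  obtain ⟨f, rfl⟩ := exists_normal_form q Q h
  have key : ∀ b c u, u ∈ normalFinset d ℓ →
      e q Q b * (polToHecke q Q (f u) * wordProd (Tn q Q) u) * e q Q c = 0 := by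
    intro b c u hu
    by_cases hu' : u ∈ blockWords b c
    · have h1 := block_normal_form q Q f b c
      rw [hh] at h1
      have h2 := coeff_eq_zero_of_sum_block q Q h1.symm u hu'
      rw [← mul_assoc, e_mul_polToHecke_eq_zero q Q h2, zero_mul, zero_mul]
    · rw [← mul_assoc, e_mul_polToHecke, mul_assoc, mul_assoc, ← mul_assoc (e q Q b),
        block_word_eq_zero q Q hu hu', mul_zero]
  calc _ = (∑ b, e q Q b) * (∑ u ∈ normalFinset d ℓ,
        polToHecke q Q (f u) * wordProd (Tn q Q) u) * ∑ c, e q Q c := by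
          rw [sum_e, one_mul, mul_one]
    _ = 0 := by
      rw [Finset.sum_mul, Finset.sum_mul]
      refine Finset.sum_eq_zero fun b _ => ?_
      rw [Finset.mul_sum]
      refine Finset.sum_eq_zero fun c _ => ?_
      rw [Finset.mul_sum, Finset.sum_mul]
      exact Finset.sum_eq_zero fun u hu => key b c u hu

end Faithful

/-! ### The centre -/

section Centre

variable {d ℓ : ℕ} {k : Type*} [Field k] (q : k) (Q : Fin ℓ → k)

theorem nil_mem_blockWords (c : J d ℓ) : [] ∈ blockWords c c :=
  mem_blockWords.2 ⟨mem_normalFinset.2 (nil_mem_normalWords _), c.permute_one, monoRed_one c⟩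

/-- A diagonal block that commutes with multiplication by the black variables is a scalar: an
order preserving permutation that fixes all black positions is the identity. -/
theorem exists_scalar_of_commute {h : Hecke d q Q} {c : J d ℓ}
    (hX : ∀ i, c.1 i = 0 → h * X q Q i = X q Q i * h) :
    ∃ a, block (rep d q Q h) c c = fun f => a * f := by
  have hmem : block (rep d q Q h) c c ∈ Submodule.span (LaurentField k (ℓ + d))
      (Set.range fun w : RedPerm c c =>
        (fun f => act k w.1 f : LaurentField k (ℓ + d) → LaurentField k (ℓ + d))) := by
    rw [← (blocks_linearIndependent_and_span q Q c c).2]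
    obtain ⟨f, rfl⟩ := exists_normal_form q Q h
    rw [block_normal_form]
    exact Submodule.sum_mem _ fun u hu => Submodule.smul_mem _ _
      (Submodule.subset_span ⟨⟨u, hu⟩, rfl⟩)
  have := Fintype.ofFinite (RedPerm c c)
  obtain ⟨a, ha⟩ := (Submodule.mem_span_range_iff_exists_fun _).1 hmem
  have ha' : ∀ f, block (rep d q Q h) c c f = ∑ w, a w * act k w.1 f := by
    intro f
    rw [← ha, Finset.sum_apply]
    rfl
  have hcomm : ∀ i, c.1 i = 0 → ∀ f,
      block (rep d q Q h) c c (fracX k i * f) = fracX k i * block (rep d q Q h) c c f := by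
    intro i hi' f
    have h1 := LinearMap.congr_fun (congrArg (rep d q Q) (hX i hi')) (Finsupp.single c f)
    rw [map_mul, map_mul, rep_X, Module.End.mul_apply, Module.End.mul_apply, opX_single,
      if_pos hi', opX] at h1
    have h2 := DFunLike.congr_fun h1 c
    rw [diagOp_apply, if_pos hi'] at h2
    exact h2
  have hzero : ∀ w : RedPerm c c, w.1 ≠ 1 → a w = 0 := by
    intro w hw
    obtain ⟨i, hi', hwi⟩ : ∃ i, c.1 i = 0 ∧ w.1 i ≠ i := by
      by_contra! hcon
      exact hw (w.2.2.eq_of_eq_on_black (monoRed_one c) hcon)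
    have h1 := linearIndependent_redPerm (k := k) c c
    rw [Fintype.linearIndependent_iff] at h1
    have h2 := h1 (fun v => a v * (fracX k (v.1 i) - fracX k i)) ?_ w
    · exact (mul_eq_zero.1 h2).resolve_right (fracX_sub_ne_zero hwi)
    · funext f
      have h3 := hcomm i hi' f
      rw [ha', ha', Finset.mul_sum, ← sub_eq_zero, ← Finset.sum_sub_distrib] at h3
      rw [Finset.sum_apply, Pi.zero_apply, ← h3]
      refine Finset.sum_congr rfl fun v _ => ?_
      rw [map_mul, act_fracX, Pi.smul_apply, smul_eq_mul]
      ring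
  refine ⟨a ⟨1, c.permute_one, monoRed_one c⟩, funext fun f => ?_⟩
  rw [ha', Finset.sum_eq_single ⟨1, c.permute_one, monoRed_one c⟩]
  · rw [act_one]
  · intro w _ hw
    rw [hzero w fun h => hw (Subtype.ext h), zero_mul]
  · simp

/-- Central elements are diagonal. -/
theorem center_le_range {z : Hecke d q Q} (hz : ∀ x, z * x = x * z) :
    ∃ f : Pol d ℓ k, z = polToHecke q Q f := by
  obtain ⟨f, hf⟩ := exists_normal_form q Q z
  refine ⟨f [], rep_injective q Q (ext_block fun b c => ?_)⟩
  rw [rep_polToHecke]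
  by_cases hbc : b = c
  · subst hbc
    obtain ⟨a, ha⟩ := exists_scalar_of_commute q Q (c := b) fun i _ => hz (X q Q i)
    -- Compare coefficients at the empty word, whose block is the identity.
    have hnil : block (rep d q Q (wordProd (Tn q Q) [])) b b = fun g => g := by
      funext g
      unfold block
      rw [wordProd_nil, map_one, Module.End.one_apply, Finsupp.single_eq_same]
    have hsum : ∑ u ∈ blockWords b b, (polValue (f u) b - if u = [] then a else 0) •
        block (rep d q Q (wordProd (Tn q Q) u)) b b = 0 := by
      simp only [sub_smul]
      rw [Finset.sum_sub_distrib, ← block_normal_form, ← hf, ha,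
        Finset.sum_eq_single_of_mem [] (nil_mem_blockWords b), if_pos rfl, hnil]
      · exact sub_self _
      · intro u _ hu
        rw [if_neg hu, zero_smul]
    have h0 := coeff_eq_zero_of_sum_block q Q hsum [] (nil_mem_blockWords b)
    rw [if_pos rfl, sub_eq_zero] at h0
    rw [ha]
    funext g
    unfold block
    rw [diagOp_single, Finsupp.single_eq_same, h0]
  · funext g
    unfold block
    rw [diagOp_single, Finsupp.single_eq_of_ne hbc, ← opE_single_self c g, ← rep_e q Q,
      ← Module.End.mul_apply, ← map_mul, hz, map_mul, Module.End.mul_apply, rep_e, opE,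
      diagOp_apply, Pi.single_eq_of_ne hbc, zero_mul]

/-- Equivariance of a family of rational functions under adjacent transpositions. -/
def SwapInvariant (F : J d ℓ → LaurentField k (ℓ + d)) : Prop :=
  ∀ r (hr : r + 1 < ℓ + d) c, act k (Equiv.swap (lo r hr) (hi r hr)) (F c)
    = F (c.permute (Equiv.swap (lo r hr) (hi r hr)))

theorem swapInvariant_of_central {f : Pol d ℓ k}
    (hf : ∀ x, polToHecke q Q f * x = x * polToHecke q Q f) : SwapInvariant (polValue f) := by
  intro r hr c
  by_cases h : c.1 (lo r hr) = 1 ∧ c.1 (hi r hr) = 1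
  · rw [J.permute_swap_of_eq (h.1.trans h.2.symm)]
    unfold polValue
    rw [act_embed Subtype.val_injective]
    congr 2
    funext i
    have hi' := (Finset.mem_filter.1 i.2).2
    refine Equiv.swap_apply_of_ne_of_ne ?_ ?_
    · intro h1
      rw [h1, h.1] at hi'
      exact one_ne_zero hi'
    · intro h1
      rw [h1, h.2] at hi'
      exact one_ne_zero hi'
  · have h1 := LinearMap.congr_fun (congrArg (rep d q Q) (hf (T q Q r hr))) (Finsupp.single c 1)
    rw [map_mul, map_mul, rep_T, rep_polToHecke, Module.End.mul_apply, Module.End.mul_apply,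
      diagOp_single, opT_single, opT_single, map_add, diagOp_single, diagOp_single, map_one,
      mul_one, mul_one, mul_one, mul_comm (polValue f c), mul_comm (polValue f _)] at h1
    exact (mul_left_cancel₀ (coeffB_ne_zero q Q (lo_ne_hi r hr) h)
      (Finsupp.single_injective _ (add_left_cancel h1))).symm

theorem central_of_swapInvariant {f : Pol d ℓ k} (hf : SwapInvariant (polValue f))
    (x : Hecke d q Q) : polToHecke q Q f * x = x * polToHecke q Q f := by
  have hx : x ∈ Algebra.adjoin k ((diagAlg d q Q : Set (Hecke d q Q)) ∪ Set.range (Tn q Q)) := by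
    rw [adjoin_diagAlg_Tn]; exact Algebra.mem_top
  induction hx using Algebra.adjoin_induction with
  | mem x hx =>
    rcases hx with hx | ⟨r, rfl⟩
    · obtain ⟨g, rfl⟩ := diagAlg_le_range q Q hx
      change polToHecke q Q f * polToHecke q Q g = polToHecke q Q g * polToHecke q Q f
      rw [← map_mul, mul_comm, map_mul]
    · by_cases hr : r + 1 < ℓ + d
      · rw [Tn_of_lt q Q hr]
        refine rep_injective q Q (Finsupp.lhom_ext fun c g => ?_)
        rw [map_mul, map_mul, rep_T, rep_polToHecke, Module.End.mul_apply, Module.End.mul_apply,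
          diagOp_single, opT_single, opT_single, map_add, diagOp_single, diagOp_single, map_mul,
          hf r hr c, mul_left_comm, mul_left_comm (polValue f _) (coeffB _ _ _ _ _)]
      · rw [Tn_of_le q Q (not_lt.1 hr), zero_mul, mul_zero]
  | algebraMap a => exact (Algebra.commutes a _).symm
  | add x y _ _ hx hy => rw [mul_add, add_mul, hx, hy]
  | mul x y _ _ hx hy => rw [← mul_assoc, hx, mul_assoc, hy, mul_assoc]

theorem SwapInvariant.act_eq {F : J d ℓ → LaurentField k (ℓ + d)} (hF : SwapInvariant F)
    (w : Equiv.Perm (Fin (ℓ + d))) (c : J d ℓ) : act k w (F c) = F (c.permute w) := by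
  induction w using perm_induction with
  | one => rw [act_one, J.permute_one]
  | mul r hr w ih => rw [← act_act, ih, hF, J.permute_permute]

theorem polValue_permutePol (w : Equiv.Perm (Fin (ℓ + d))) (f : Pol d ℓ k) (c : J d ℓ) :
    polValue (permutePol k w f) c = act k w (polValue f (c.permute w⁻¹)) := by
  unfold polValue
  rw [act_embed Subtype.val_injective]
  change embed _ (Laurent.rename k (blacksEquiv w c) (f (c.permute w⁻¹))) = _
  rw [embed_rename Subtype.val_injective]
  rfl

theorem mem_invariantPol_iff (f : Pol d ℓ k) :
    f ∈ invariantPol d ℓ k ↔ SwapInvariant (polValue f) := by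
  have h1 : f ∈ invariantPol d ℓ k ↔ ∀ w, permutePol k w f = f := by
    unfold invariantPol
    rw [Algebra.mem_iInf]
    exact Iff.rfl
  rw [h1]
  constructor
  · intro h r hr c
    have h2 := congrFun (congrArg polValue (h (Equiv.swap (lo r hr) (hi r hr))))
      (c.permute (Equiv.swap (lo r hr) (hi r hr)))
    rw [polValue_permutePol, Equiv.swap_inv, J.permute_swap_swap] at h2
    exact h2
  · intro h w
    refine polValue_injective (funext fun c => ?_)
    rw [polValue_permutePol, h.act_eq, J.permute_permute, mul_inv_cancel, J.permute_one]

theorem center_eq_map_invariantPol :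
    Subalgebra.center k (Hecke d q Q) = (invariantPol d ℓ k).map (polToHecke q Q) := by
  ext z
  rw [Subalgebra.mem_center_iff, Subalgebra.mem_map]
  constructor
  · intro hz
    obtain ⟨f, rfl⟩ := center_le_range q Q fun x => (hz x).symm
    exact ⟨f, (mem_invariantPol_iff f).2 (swapInvariant_of_central q Q fun x => (hz x).symm), rfl⟩
  · rintro ⟨f, hf, rfl⟩ x
    exact (central_of_swapInvariant q Q ((mem_invariantPol_iff f).1 hf) x).symm

/-- The family in `⨁_c P(c)` with the same Laurent polynomial in each component. -/
def diagPol (g : Laurent k (Fin d)) : Pol d ℓ k := fun c =>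
  Laurent.rename k c.blackIso.toEquiv g

theorem polToHecke_diagPol (g : Laurent k (Fin d)) :
    polToHecke q Q (diagPol g) = laurentToHecke d q Q g := by
  change (∑ c : J d ℓ, laurentToHecke d q Q (Laurent.rename k c.blackIso.symm.toEquiv
    (Laurent.rename k c.blackIso.toEquiv g)) * e q Q c) = _
  rw [← mul_one (laurentToHecke d q Q g), ← sum_e, Finset.mul_sum]
  refine Finset.sum_congr rfl fun c _ => ?_
  congr 2
  exact (Laurent.rename k c.blackIso.toEquiv).symm_apply_apply g

theorem polValue_diagPol (g : Laurent k (Fin d)) (c : J d ℓ) :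
    polValue (diagPol g) c = embed c.pos g := (embed_pos c g).symm

theorem mem_symmetricLaurent_iff (g : Laurent k (Fin d)) :
    g ∈ symmetricLaurent k d ↔ ∀ σ, Laurent.rename k σ g = g := by
  unfold symmetricLaurent
  rw [Algebra.mem_iInf]
  exact Iff.rfl

theorem J.permute_eq_of_pos {w : Equiv.Perm (Fin (ℓ + d))} {b c : J d ℓ}
    (σ : Fin d → Fin d) (h : ∀ t, w (c.pos t) = b.pos (σ t)) : c.permute w = b := by
  refine J.eq_of_black_imp fun i hi' => ?_
  rw [J.permute_apply] at hi'
  obtain ⟨t, ht⟩ := c.exists_pos_eq hi'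
  have h1 := h t
  rw [ht, show w (w⁻¹ i) = i by simp] at h1
  rw [h1]
  exact b.pos_black _

/-- An invariant family is determined by one component, and this component is symmetric, because
permutations match the black positions of any two colour sequences in any prescribed way. -/
theorem swapInvariant_iff (f : Pol d ℓ k) :
    SwapInvariant (polValue f) ↔ ∃ g ∈ symmetricLaurent k d, f = diagPol g := by
  constructor
  · intro h
    obtain ⟨b⟩ := (inferInstance : Nonempty (J d ℓ))
    set g := Laurent.rename k b.blackIso.toEquiv.symm (f b) with hg
    have hb : polValue f b = embed b.pos g := by
      rw [embed_pos, hg, Laurent.rename_symm_rename]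
      rfl
    have key : ∀ (c : J d ℓ) (σ : Equiv.Perm (Fin d)),
        polValue f c = embed c.pos (Laurent.rename k σ g) := by
      intro c σ
      obtain ⟨w, hw⟩ := exists_perm_comp_eq b.pos_injective (c.pos_injective.comp σ.injective)
      rw [← J.permute_eq_of_pos σ hw, ← h.act_eq, hb, act_embed b.pos_injective,
        J.permute_eq_of_pos σ hw, embed_rename c.pos_injective]
      congr 2
      exact funext hw
    refine ⟨g, (mem_symmetricLaurent_iff g).2 fun σ => ?_, ?_⟩
    · exact embed_injective b.pos_injective ((key b σ).symm.trans hb)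
    · refine polValue_injective (funext fun c => ?_)
      rw [key c 1, polValue_diagPol]
      congr 1
      exact embed_injective b.pos_injective ((key b 1).symm.trans hb)
  · rintro ⟨g, hg, rfl⟩ r hr c
    set s := Equiv.swap (lo r hr) (hi r hr) with hs
    -- `s` permutes the black positions up to a permutation of their numbering.
    have h1 : ∀ t, ∃ t', (c.permute s).pos t' = s (c.pos t) := fun t =>
      (c.permute s).exists_pos_eq ((c.permute_apply_apply s _).trans (c.pos_black t))
    choose σ hσ using h1
    have hinj : Function.Injective σ := by
      intro t t' htt
      have := hσ t
      rw [htt, hσ t'] at this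
      exact (c.pos_injective (s.injective this)).symm
    have hb := Finite.injective_iff_bijective.1 hinj
    rw [polValue_diagPol, polValue_diagPol, act_embed c.pos_injective]
    conv_rhs => rw [← (mem_symmetricLaurent_iff g).1 hg (Equiv.ofBijective σ hb)]
    rw [embed_rename (c.permute s).pos_injective]
    congr 2
    exact funext fun t => (hσ t).symm

theorem map_symmetricLaurent_eq :
    (symmetricLaurent k d).map (laurentToHecke d q Q)
      = (invariantPol d ℓ k).map (polToHecke q Q) := by
  ext z
  rw [Subalgebra.mem_map, Subalgebra.mem_map]
  constructor
  · rintro ⟨g, hg, rfl⟩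
    exact ⟨diagPol g, (mem_invariantPol_iff _).2 ((swapInvariant_iff _).2 ⟨g, hg, rfl⟩),
      polToHecke_diagPol q Q g⟩
  · rintro ⟨f, hf, rfl⟩
    obtain ⟨g, hg, rfl⟩ := (swapInvariant_iff f).1 ((mem_invariantPol_iff f).1 hf)
    exact ⟨g, hg, (polToHecke_diagPol q Q g).symm⟩

theorem center_eq_map_symmetricLaurent :
    Subalgebra.center k (Hecke d q Q) = (symmetricLaurent k d).map (laurentToHecke d q Q) := by
  rw [map_symmetricLaurent_eq, center_eq_map_invariantPol]

/-- The centre as the algebra of symmetric Laurent polynomials. -/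
def symmetricEquivCenter :
    symmetricLaurent k d ≃ₐ[k] Subalgebra.center k (Hecke d q Q) :=
  ((symmetricLaurent k d).equivMapOfInjective (laurentToHecke d q Q)
    (laurentToHecke_injective q Q)).trans
    (Subalgebra.equivOfEq _ _ (center_eq_map_symmetricLaurent q Q).symm)

end Centre

end

end HigherHecke

theorem mainTheorem8 {k : Type*} [Field k] (q : k) (hq0 : q ≠ 0) (hq1 : q ≠ 1) (d ℓ : ℕ)
    (Q : Fin ℓ → k) (hQ : ∀ i, Q i ≠ 0) :
    Function.Injective (HigherHecke.laurentToHecke d q Q) ∧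
    Function.Injective (HigherHecke.polToHecke (d := d) q Q) ∧
    Subalgebra.center k (HigherHecke.Hecke d q Q) =
      (HigherHecke.symmetricLaurent k d).map (HigherHecke.laurentToHecke d q Q) ∧
    (HigherHecke.symmetricLaurent k d).map (HigherHecke.laurentToHecke d q Q) =
      (HigherHecke.invariantPol d ℓ k).map (HigherHecke.polToHecke q Q) ∧
    ∀ (ℓ' : ℕ) (Q' : Fin ℓ' → k), (∀ i, Q' i ≠ 0) →
      ∃ φ : Subalgebra.center k (HigherHecke.Hecke d q Q) ≃ₐ[k]
          Subalgebra.center k (HigherHecke.Hecke d q Q'),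
        ∀ f ∈ HigherHecke.symmetricLaurent k d, ∀ z : Subalgebra.center k (HigherHecke.Hecke d q Q),
          (z : HigherHecke.Hecke d q Q) = HigherHecke.laurentToHecke d q Q f →
          (φ z : HigherHecke.Hecke d q Q') = HigherHecke.laurentToHecke d q Q' f := by
  refine ⟨HigherHecke.laurentToHecke_injective q Q, HigherHecke.polToHecke_injective q Q,
    HigherHecke.center_eq_map_symmetricLaurent q Q, HigherHecke.map_symmetricLaurent_eq q Q,
    fun ℓ' Q' _ => ⟨(HigherHecke.symmetricEquivCenter q Q).symm.trans
      (HigherHecke.symmetricEquivCenter q Q'), fun f hf z hz => ?_⟩⟩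
  obtain rfl : z = HigherHecke.symmetricEquivCenter q Q ⟨f, hf⟩ := Subtype.ext hz
  rw [AlgEquiv.trans_apply, AlgEquiv.symm_apply_apply]
  rfl
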